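/- Let $\mathcal H_n$ be a complex Hilbert space of finite dimension $n>1$, let $\mathfrak B(\mathcal H_n)$ be the space of its linear operators, $iu(n)\subset\mathfrak B(\mathcal H_n)$ the real space of self-adjoint operators and $U(n)$ the group of unitary operators. Identify the projective space $\mathcal P=\mathsf P(\mathcal H_n)$ with the set of rank-one projectors $p=\psi\langle\psi|\cdot\rangle$, $\|\psi\|=1$, with its usual structure of a real $(2n-2)$-dimensional smooth manifold, given by the affine charts $[z]\mapsto(z_j/z_h)_{j\ne h}$. Tangent vectors at $p$ are identified with the operators $v=-i[A_v,p]$, $A_v\in iu(n)$. Fix a constant $\kappa>0$ and equip $\mathcal P$ with the symplectic form $\omega_p(u,v)=-i\kappa\,\mathrm{tr}(p[A_u,A_v])$; the Hamiltonian vector field $X_f$ of a $C^1$ function $f:\mathcal P\to\mathbb R$ is defined by $\omega_p(X_f(p),\cdot)=df_p$. Let $\mathcal O:iu(n)\ni A\mapsto f_A$ be a map that takes self-adjoint operators to functions $f_A:\mathcal P\to\mathbb R$, and consider the requirements: (O1) $\mathcal O$ is injective. (O2) $\mathcal O$ is $\mathbb R$-linear. (O3) For every $H\in iu(n)$ the function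 $f_H$ is $C^1$, and a curve $p=p(t)\in\mathcal P$, $t\in(a,b)$, satisfies Hamilton's equation $\frac{dp}{dt}=X_{f_H}(p(t))$ on $(a,b)$ if and only if it satisfies Schrödinger's equation $\frac{dp}{dt}=-i[H,p(t)]$ on $(a,b)$. (O4) $f_A(UpU^{-1})=f_{U^{-1}AU}(p)$ for all $A\in iu(n)$, $U\in U(n)$, $p\in\mathcal P$. Let $\mu_n$ be the $U(n)$-invariant Borel probability measure on $\mathcal P$, that is, the image of the normalized surface measure of the unit sphere of $\mathcal H_n$ under $\psi\mapsto\psi\langle\psi|\cdot\rangle$. A basis of $\mathcal P$ is a set $N\subset\mathcal P$ that is maximal with the property that $\|p-q\|_2=\sqrt2$ (Hilbert–Schmidt norm) for all distinct $p,q\in N$; it has $n$ elements. A function $F:\mathcal P\to\mathbb C$ is a frame function if there is $W\in\mathbb C$ with $\sum_{i=1}^nF(x_i)=W$ for every basis $\{x_1,\dots,x_n\}$ of $\mathcal P$, and $\mathcal F^2(\mathcal H_n)$ denotes the set of all frame functions that belong to $\mathcal L^2(\mathcal P,\mu_n)$. **Theorem.** (a) The requirements (O1)–(O4) hold if and only if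 there is a constant $c\in\mathbb R$ with $\kappa+nc\neq0$ such that $$f_A(p)=\kappa\,\mathrm{tr}(pA)+c\,\mathrm{tr}A\qquad\text{for all }A\in iu(n),\ p\in\mathcal P,$$ where $\kappa$ is the constant in $\omega$. (b) If the requirements (O1)–(O4) hold, then $\mathcal O$ extends, in a unique way, to a $\mathbb C$-linear map from $\mathfrak B(\mathcal H_n)$ to the functions $\mathcal P\to\mathbb C$. This extension is injective and, if $n>2$, its image is exactly $\mathcal F^2(\mathcal H_n)$. -/

import Mathlib

noncomputable section
namespace QuantumProj

open scoped InnerProductSpace Manifold ContDiff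
open MeasureTheory Module

set_option linter.unusedSectionVars false
set_option linter.unusedSimpArgs false

variable {H : Type*} [NormedAddCommGroup H] [InnerProductSpace ℂ H] [FiniteDimensional ℂ H]

/-- The complex projective space of the Hilbert space `H`, identified as usual with the set of pure
states: the class `[ψ]` of a unit vector `ψ` is the rank-one projector `ψ⟨ψ|·⟩` in `𝔅(H)`. -/
@[ext]
structure ProjSpace (H : Type*) [NormedAddCommGroup H] [InnerProductSpace ℂ H] where
  op : H →L[ℂ] H
  isPure : ∃ ψ : H, ‖ψ‖ = 1 ∧ op = InnerProductSpace.rankOne ℂ ψ ψ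

/-- The topology of the operator norm. -/
instance : TopologicalSpace (ProjSpace H) := TopologicalSpace.induced ProjSpace.op inferInstance

lemma continuous_op : Continuous (ProjSpace.op : ProjSpace H → H →L[ℂ] H) := continuous_induced_dom

/-! ### The smooth structure, by the affine charts `[z] ↦ (z_j / z_h)_{j ≠ h}`

`H` is identified with `ℂⁿ`, `n = dim H`, by a Hilbert basis; the complex coordinates are regarded as
pairs of real ones, i.e. everything is differentiated over `ℝ`. -/

/-- The chosen Hilbert basis of `H`. -/
def basisVec (H : Type*) [NormedAddCommGroup H] [InnerProductSpace ℂ H] [FiniteDimensional ℂ H] :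
    OrthonormalBasis (Fin (finrank ℂ H)) ℂ H := stdOrthonormalBasis ℂ H

/-- The model space `ℂ^(n-1) = ℝ^(2n-2)`. -/
abbrev ModelE (H : Type*) [NormedAddCommGroup H] [InnerProductSpace ℂ H] : Type :=
  Fin (finrank ℂ H - 1) → ℂ

/-- An enumeration of the indices different from `h`. -/
def otherIdx (h : Fin (finrank ℂ H)) : Fin (finrank ℂ H - 1) ≃ {j // j ≠ h} :=
  (Fintype.equivFinOfCardEq (by simp)).symm

/-- The matrix element `A_{jh} = ⟨b_j, A b_h⟩`. -/
def entry (A : H →L[ℂ] H) (j h : Fin (finrank ℂ H)) : ℂ :=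
  ⟪basisVec H j, A (basisVec H h)⟫_ℂ

/-- The vector whose `h`-th coordinate is `1` and whose other coordinates are `w`. -/
def affVec (h : Fin (finrank ℂ H)) (w : ModelE H) : H :=
  basisVec H h + ∑ i, w i • basisVec H (otherIdx h i)

/-- For `φ ≠ 0`, the rank-one projector onto the line spanned by `φ`. -/
def ray (φ : H) : H →L[ℂ] H := ((‖φ‖ ^ 2)⁻¹ : ℝ) • InnerProductSpace.rankOne ℂ φ φ

lemma ray_smul (φ : H) (c : ℂ) (hc : c ≠ 0) : ray (c • φ) = ray φ := by
  ext x
  have h1 : (‖c‖:ℂ) ≠ 0 := by simpa using hc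
  by_cases h : φ = 0
  · simp [h]
  have h2 : (‖φ‖:ℂ) ≠ 0 := by simpa using h
  simp only [ray, smul_apply, InnerProductSpace.rankOne_apply, inner_smul_left,
    norm_smul, smul_smul, ← Complex.coe_smul]
  congr 1
  have : (starRingEnd ℂ) c * c = (‖c‖:ℂ)^2 := Complex.conj_mul' c
  push_cast
  field_simp
  linear_combination ⟪φ, x⟫_ℂ * this

lemma ray_unit (φ : H) (h : ‖φ‖ = 1) : ray φ = InnerProductSpace.rankOne ℂ φ φ := by
  simp [ray, h]

lemma ray_mem (φ : H) (h : φ ≠ 0) :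
    ∃ ψ : H, ‖ψ‖ = 1 ∧ ray φ = InnerProductSpace.rankOne ℂ ψ ψ := by
  have h2 : (‖φ‖:ℂ) ≠ 0 := by simpa using h
  refine ⟨((‖φ‖ : ℂ)⁻¹) • φ, ?_, ?_⟩
  · simp [norm_smul, h]
  · rw [← ray_smul φ _ (inv_ne_zero h2), ray_unit]
    simp [norm_smul, h]

lemma inner_affVec_self (h : Fin (finrank ℂ H)) (w : ModelE H) :
    ⟪basisVec H h, affVec h w⟫_ℂ = 1 := by
  have : ∀ i, ¬ h = (otherIdx h i : Fin (finrank ℂ H)) := fun i => (otherIdx h i).2.symm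
  simp [affVec, inner_add_right, inner_sum, inner_smul_right,
    orthonormal_iff_ite.mp (basisVec H).orthonormal, this]

lemma inner_affVec (h : Fin (finrank ℂ H)) (w : ModelE H) (i) :
    ⟪basisVec H (otherIdx h i), affVec h w⟫_ℂ = w i := by
  have : ¬ (otherIdx h i : Fin (finrank ℂ H)) = h := (otherIdx h i).2
  simp [affVec, inner_add_right, inner_sum, inner_smul_right,
    orthonormal_iff_ite.mp (basisVec H).orthonormal, this, Subtype.val_inj]

lemma affVec_ne_zero (h : Fin (finrank ℂ H)) (w : ModelE H) : affVec h w ≠ 0 := by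
  intro h0
  have := inner_affVec_self h w
  simp [h0] at this

lemma affVec_coord (h : Fin (finrank ℂ H)) (ψ : H) (hψ : ⟪basisVec H h, ψ⟫_ℂ ≠ 0) :
    affVec h (fun i => ⟪basisVec H (otherIdx h i), ψ⟫_ℂ / ⟪basisVec H h, ψ⟫_ℂ) =
      (⟪basisVec H h, ψ⟫_ℂ)⁻¹ • ψ := by
  have key : ψ = ⟪basisVec H h, ψ⟫_ℂ • basisVec H h +
      ∑ i, ⟪basisVec H (otherIdx h i), ψ⟫_ℂ • basisVec H (otherIdx h i) := by
    conv_lhs => rw [← (basisVec H).sum_repr' ψ, Fintype.sum_eq_add_sum_subtype_ne _ h]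
    rw [← (otherIdx h).sum_comp]
  generalize ⟪basisVec H h, ψ⟫_ℂ = c at *
  rw [affVec, eq_inv_smul_iff₀ hψ, smul_add, Finset.smul_sum]
  conv_rhs => rw [key]
  congr 1
  refine Finset.sum_congr rfl fun i _ => ?_
  rw [smul_smul, mul_div_cancel₀ _ hψ]

lemma entry_ray (φ : H) (j h) : entry (ray φ) j h =
    ((‖φ‖ ^ 2)⁻¹ : ℝ) * (⟪basisVec H j, φ⟫_ℂ * ⟪φ, basisVec H h⟫_ℂ) := by
  simp only [entry, ray, smul_apply, InnerProductSpace.rankOne_apply, inner_smul_right,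
    ← Complex.coe_smul]
  ring

lemma entry_affVec_ne (h : Fin (finrank ℂ H)) (w : ModelE H) :
    entry (ray (affVec h w)) h h ≠ 0 := by
  rw [entry_ray, ← inner_conj_symm (affVec h w), inner_affVec_self]
  simp [affVec_ne_zero]

lemma continuous_entry (j h) : Continuous (fun A : H →L[ℂ] H => entry A j h) := by
  unfold entry; fun_prop

lemma contDiff_entry (j h) : ContDiff ℝ ∞ (fun A : H →L[ℂ] H => entry A j h) := by
  unfold entry
  have : ContDiff ℝ ∞ (fun A : H →L[ℂ] H => A (basisVec H h)) :=
    ((ContinuousLinearMap.apply ℂ H (basisVec H h)).restrictScalars ℝ).contDiff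
  exact ContDiff.inner ℂ contDiff_const this

lemma contDiffAt_quot {E : Type*} [NormedAddCommGroup E] [NormedSpace ℝ E] {f g : E → ℂ} {x : E}
    (hf : ContDiffAt ℝ ∞ f x) (hg : ContDiffAt ℝ ∞ g x) (h0 : g x ≠ 0) :
    ContDiffAt ℝ ∞ (fun y => f y / g y) x := by
  simp only [div_eq_mul_inv]
  exact hf.mul (hg.inv h0)

lemma contDiff_affVec (h : Fin (finrank ℂ H)) : ContDiff ℝ ∞ (affVec h : ModelE H → H) := by
  unfold affVec
  refine contDiff_const.add (ContDiff.sum fun i _ => ?_)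
  exact ContDiff.smul (contDiff_apply ℝ ℂ i) contDiff_const

lemma isBoundedBilinear_rankOne :
    IsBoundedBilinearMap ℝ (fun q : H × H => InnerProductSpace.rankOne ℂ q.1 q.2) := by
  constructor
  · intros; simp
  · intros; ext; simp
  · intros; simp
  · intro c x y; ext z; simp [smul_smul, ← Complex.coe_smul]
  · exact ⟨1, one_pos, by intros; simp⟩

lemma contDiff_ray_affVec (h : Fin (finrank ℂ H)) :
    ContDiff ℝ ∞ (fun w : ModelE H => ray (affVec h w)) := by
  unfold ray
  refine ContDiff.smul (ContDiff.inv ((contDiff_affVec h).norm_sq ℂ) ?_) ?_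
  · intro w; simp [affVec_ne_zero]
  · exact isBoundedBilinear_rankOne.contDiff.comp ((contDiff_affVec h).prodMk (contDiff_affVec h))

/-- The affine chart  `[z] ↦ (z_j / z_h)_{j ≠ h}`, defined where `z_h ≠ 0`; for `p = ψ⟨ψ|·⟩`
the ratio `ψ_j / ψ_h` is `p_{jh} / p_{hh}`. The inverse sends `w` to the line of `affVec h w`. -/
def affChart (h : Fin (finrank ℂ H)) : OpenPartialHomeomorph (ProjSpace H) (ModelE H) where
  toFun p := fun i => entry p.op (otherIdx h i) h / entry p.op h h
  invFun w := ⟨ray (affVec h w), ray_mem _ (affVec_ne_zero h w)⟩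
  source := {p | entry p.op h h ≠ 0}
  target := Set.univ
  map_source' _ _ := trivial
  map_target' w _ := entry_affVec_ne h w
  left_inv' := by
    rintro ⟨p, ψ, h1, rfl⟩ hp
    apply ProjSpace.ext
    replace hp : entry (InnerProductSpace.rankOne ℂ ψ ψ) h h ≠ 0 := hp
    simp only [← ray_unit ψ h1, entry_ray] at hp ⊢
    have h2 : ⟪basisVec H h, ψ⟫_ℂ ≠ 0 := by rintro h0; simp [h0] at hp
    have h3 : ⟪ψ, basisVec H h⟫_ℂ ≠ 0 := by rintro h0; simp [h0] at hp
    rw [← ray_smul ψ _ (inv_ne_zero h2), ← affVec_coord h ψ h2]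
    congr 2
    funext i
    simp [h1]
    field_simp
  right_inv' := by
    intro w _
    funext i
    have h0 := entry_affVec_ne h w
    simp only [entry_ray, inner_affVec, inner_affVec_self] at h0 ⊢
    have h1 := left_ne_zero_of_mul h0
    have h2 := right_ne_zero_of_mul (right_ne_zero_of_mul h0)
    generalize (((‖affVec h w‖ ^ 2)⁻¹ : ℝ) : ℂ) = r at *
    field_simp
  open_source := by
    have : Continuous fun p : ProjSpace H => entry p.op h h :=
      (continuous_entry h h).comp continuous_op
    exact isOpen_ne.preimage this
  open_target := isOpen_univ
  continuousOn_toFun := by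
    refine continuousOn_pi.2 fun i => ContinuousOn.div ?_ ?_ fun p hp => hp
    · exact ((continuous_entry _ _).comp continuous_op).continuousOn
    · exact ((continuous_entry _ _).comp continuous_op).continuousOn
  continuousOn_invFun :=
    (continuous_induced_rng.2 (contDiff_ray_affVec h).continuous).continuousOn

lemma exists_mem_affChart_source (p : ProjSpace H) : ∃ h, p ∈ (affChart h).source := by
  obtain ⟨p, ψ, h1, rfl⟩ := p
  by_contra! hc
  have : ∀ h, ⟪basisVec H h, ψ⟫_ℂ = 0 := by
    intro h
    have : entry (InnerProductSpace.rankOne ℂ ψ ψ) h h = 0 := not_not.1 (hc h)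
    rw [← ray_unit ψ h1, entry_ray, ← inner_conj_symm ψ (basisVec H h)] at this
    have h3 : ⟪basisVec H h, ψ⟫_ℂ * (starRingEnd ℂ) ⟪basisVec H h, ψ⟫_ℂ = 0 := by
      simpa only [h1, one_pow, inv_one, Complex.ofReal_one, one_mul] using this
    rwa [Complex.mul_conj, Complex.ofReal_eq_zero, Complex.normSq_eq_zero] at h3
  have h0 : ψ = 0 := by rw [← (basisVec H).sum_repr' ψ]; simp [this]
  simp [h0] at h1

instance : ChartedSpace (ModelE H) (ProjSpace H) where
  atlas := Set.range affChart
  chartAt p := affChart (exists_mem_affChart_source p).choose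
  mem_chart_source p := (exists_mem_affChart_source p).choose_spec
  chart_mem_atlas _ := Set.mem_range_self _

instance : IsManifold 𝓘(ℝ, ModelE H) ∞ (ProjSpace H) := by
  apply isManifold_of_contDiffOn
  rintro _ _ ⟨h, rfl⟩ ⟨k, rfl⟩
  refine contDiffOn_pi.2 fun i => ?_
  have h1 := ((contDiff_entry (H := H) (otherIdx k i) k).comp (contDiff_ray_affVec h))
  have h2 := ((contDiff_entry (H := H) k k).comp (contDiff_ray_affVec h))
  intro w hw
  exact (contDiffAt_quot h1.contDiffAt h2.contDiffAt hw.1.2).contDiffWithinAt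


variable [CompleteSpace H]

/-! ### Tangent vectors as operators -/

/-- The commutator `[A, B]`. -/
def comm (A B : H →L[ℂ] H) : H →L[ℂ] H := A * B - B * A

lemma comm_skew (A B : H →L[ℂ] H) : -comm B A = comm A B := by simp [comm]

/-- The trace on `𝔅(H)`. -/
def tr (A : H →L[ℂ] H) : ℂ := LinearMap.trace ℂ H (A : H →ₗ[ℂ] H)

/-- The tangent vectors at `p`, seen as operators: the differential of the inclusion
`p ↦ p` of the projective space into `𝔅(H)`. -/
def tangentOp (p : ProjSpace H) : TangentSpace 𝓘(ℝ, ModelE H) p →L[ℝ] (H →L[ℂ] H) :=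
  mfderiv 𝓘(ℝ, ModelE H) 𝓘(ℝ, H →L[ℂ] H) (fun q : ProjSpace H => q.op) p

lemma contMDiff_val : ContMDiff 𝓘(ℝ, ModelE H) 𝓘(ℝ, H →L[ℂ] H) ∞ (fun q : ProjSpace H => q.op) := by
  intro q
  rw [contMDiffAt_iff_of_mem_source (mem_chart_source _ q) (mem_chart_source _ _)]
  refine ⟨continuous_op.continuousAt, ?_⟩
  exact (contDiff_ray_affVec (exists_mem_affChart_source q).choose).contDiffAt.contDiffWithinAt

lemma mdiff_val (q : ProjSpace H) : MDifferentiableAt 𝓘(ℝ, ModelE H) 𝓘(ℝ, H →L[ℂ] H)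
    (fun q : ProjSpace H => q.op) q := contMDiff_val.mdifferentiableAt (by simp)

/-- local smooth left inverse of the inclusion -/
def ambientChart (h : Fin (finrank ℂ H)) (A : H →L[ℂ] H) : ModelE H :=
  fun i => entry A (otherIdx h i) h / entry A h h

lemma contDiffAt_ambientChart (h : Fin (finrank ℂ H)) (A : H →L[ℂ] H) (hA : entry A h h ≠ 0) :
    ContDiffAt ℝ ∞ (ambientChart h) A :=
  contDiffAt_pi.2 fun _ => contDiffAt_quot (contDiff_entry _ _).contDiffAt (contDiff_entry _ _).contDiffAt hA

lemma tangentOp_injective (p : ProjSpace H) : Function.Injective (tangentOp p) := by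
  obtain ⟨h, hp⟩ : ∃ h, p ∈ (affChart h).source := exists_mem_affChart_source p
  have hat : affChart h ∈ atlas (ModelE H) (ProjSpace H) := ⟨h, rfl⟩
  have e1 : mfderiv 𝓘(ℝ, ModelE H) 𝓘(ℝ, ModelE H) (affChart h) p =
      (mfderiv 𝓘(ℝ, H →L[ℂ] H) 𝓘(ℝ, ModelE H) (ambientChart h) p.op).comp (tangentOp p) := by
    exact mfderiv_comp p (g := ambientChart h) (f := fun q : ProjSpace H => q.op)
      ((contDiffAt_ambientChart h p.op hp).differentiableAt (by simp)).mdifferentiableAt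
      (mdiff_val p)
  have e2 : Function.Injective (mfderiv 𝓘(ℝ, ModelE H) 𝓘(ℝ, ModelE H) (affChart h) p) :=
    (mdifferentiable_of_mem_atlas hat).mfderiv_injective hp
  rw [e1] at e2
  exact Function.Injective.of_comp e2

lemma val_selfAdj (p : ProjSpace H) : star p.op = p.op := by
  obtain ⟨p, ψ, h1, rfl⟩ := p
  exact (InnerProductSpace.isStarProjection_rankOne_self h1).isSelfAdjoint

lemma val_idem (p : ProjSpace H) : p.op * p.op = p.op := by
  obtain ⟨p, ψ, h1, rfl⟩ := p
  exact (InnerProductSpace.isStarProjection_rankOne_self h1).isIdempotentElem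

lemma tangentOp_selfAdj (p : ProjSpace H) (u) : star (tangentOp p u) = tangentOp p u := by
  let S : (H →L[ℂ] H) →L[ℝ] (H →L[ℂ] H) := (starL' ℝ : (H →L[ℂ] H) ≃L[ℝ] (H →L[ℂ] H))
  have h2 : HasFDerivAt (fun A => S A) S p.op := S.hasFDerivAt
  have h1 := HasMFDerivAt.comp p h2.hasMFDerivAt (mdiff_val p).hasMFDerivAt
  have h3 : (fun A => S A) ∘ (fun q : ProjSpace H => q.op) = fun q => q.op := by
    funext q; exact val_selfAdj q
  rw [h3] at h1
  exact (congrArg (fun L => L u) h1.mfderiv).symm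

lemma tangentOp_leibniz (p : ProjSpace H) (u) : tangentOp p u = tangentOp p u * p.op + p.op * tangentOp p u := by
  have h2 := (hasFDerivAt_id (𝕜 := ℝ) p.op).mul' (hasFDerivAt_id (𝕜 := ℝ) p.op)
  have h1 := HasMFDerivAt.comp p h2.hasMFDerivAt (mdiff_val p).hasMFDerivAt
  have h3 : (id * id : (H →L[ℂ] H) → (H →L[ℂ] H)) ∘ (fun q : ProjSpace H => q.op) = fun q => q.op := by
    funext q; exact val_idem q
  rw [h3] at h1
  have := congrArg (fun L => L u) h1.mfderiv
  exact this.trans (add_comm _ _)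

/-- Every tangent vector at `p` is of the form `-i[A, p]` with `A` self-adjoint. -/
lemma exists_generator (p : ProjSpace H) (u : TangentSpace 𝓘(ℝ, ModelE H) p) :
    ∃ A : selfAdjoint (H →L[ℂ] H), tangentOp p u = -Complex.I • (comm (A : H →L[ℂ] H) p.op) := by
  refine ⟨⟨Complex.I • (comm (tangentOp p u) p.op), ?_⟩, ?_⟩
  · rw [selfAdjoint.mem_iff, comm, star_smul, star_sub, star_mul, star_mul, tangentOp_selfAdj,
      val_selfAdj, ← neg_sub, smul_neg]
    simp
  · have h1 := tangentOp_leibniz p u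
    have h2 := val_idem p
    show tangentOp p u = -Complex.I • (comm (Complex.I • (comm (tangentOp p u) p.op)) p.op)
    generalize tangentOp p u = v at *
    generalize p.op = q at *
    have h3 : q * v * q = 0 := by
      have h4 : q * v * q = q * (v * q + q * v) * q := by rw [← h1]
      have h5 : q * (v * q + q * v) * q = q * v * (q * q) + (q * q) * v * q := by noncomm_ring
      rw [h5, h2] at h4
      simpa using h4
    simp only [comm, smul_mul_assoc, mul_smul_comm, ← smul_sub, smul_smul]
    have h6 : (v * q - q * v) * q - q * (v * q - q * v) =
      v * (q * q) + (q * q) * v - 2 * (q * v * q) := by noncomm_ring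
    rw [h6, h2, h3, ← h1]; simp


/-! ### The symplectic form and Hamiltonian vector fields -/

/-- A self-adjoint `A_u` with `u = -i[A_u, p]`. -/
def generator (p : ProjSpace H) (u : TangentSpace 𝓘(ℝ, ModelE H) p) : selfAdjoint (H →L[ℂ] H) :=
  (exists_generator p u).choose

lemma tangentOp_eq (p : ProjSpace H) (u : TangentSpace 𝓘(ℝ, ModelE H) p) :
    tangentOp p u = -Complex.I • (comm (generator p u : H →L[ℂ] H) p.op) :=
  (exists_generator p u).choose_spec

/-- The symplectic form `ω_p(u, v) = -iκ tr(p [A_u, A_v])`. The right-hand side is real and does not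
depend on the choice of `A_u`, `A_v`: see `omega_eq`. -/
def omega (κ : ℝ) (p : ProjSpace H) (u v : TangentSpace 𝓘(ℝ, ModelE H) p) : ℝ :=
  (-Complex.I * κ * tr (p.op * (comm (generator p u : H →L[ℂ] H) (generator p v : H →L[ℂ] H)))).re

lemma tr_mul_comm (A B : H →L[ℂ] H) : tr (A * B) = tr (B * A) :=
  LinearMap.trace_mul_comm ℂ (A : H →ₗ[ℂ] H) (B : H →ₗ[ℂ] H)

lemma tr_add (A B : H →L[ℂ] H) : tr (A + B) = tr A + tr B := by simp [tr]
lemma tr_sub (A B : H →L[ℂ] H) : tr (A - B) = tr A - tr B := by simp [tr]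
lemma tr_neg (A : H →L[ℂ] H) : tr (-A) = -tr A := by simp [tr]
lemma tr_smul (c : ℂ) (A : H →L[ℂ] H) : tr (c • A) = c * tr A := by simp [tr]

lemma tr_star (A : H →L[ℂ] H) : tr (star A) = (starRingEnd ℂ) (tr A) := by
  simp only [tr]
  rw [LinearMap.trace_eq_sum_inner _ (basisVec H), LinearMap.trace_eq_sum_inner _ (basisVec H),
    map_sum]
  refine Finset.sum_congr rfl fun i _ => ?_
  simp [ContinuousLinearMap.star_eq_adjoint, ContinuousLinearMap.adjoint_inner_right]

lemma tr_star_mul_self (A : H →L[ℂ] H) (h : (tr (star A * A)).re = 0) : A = 0 := by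
  have : (tr (star A * A)).re = ∑ i, ‖A (basisVec H i)‖ ^ 2 := by
    simp only [tr]
    rw [LinearMap.trace_eq_sum_inner _ (basisVec H), Complex.re_sum]
    refine Finset.sum_congr rfl fun i _ => ?_
    simp [ContinuousLinearMap.star_eq_adjoint, ContinuousLinearMap.adjoint_inner_right, ← Complex.ofReal_pow]
  rw [this, Finset.sum_eq_zero_iff_of_nonneg (fun _ _ => by positivity)] at h
  have h2 : ∀ i, A (basisVec H i) = 0 := fun i => by simpa using h i (Finset.mem_univ i)
  ext x
  rw [← (basisVec H).sum_repr' x]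
  simp [h2]

lemma tr_comm (P A B : H →L[ℂ] H) : tr (P * (comm A B)) = tr ((comm P A) * B) := by
  simp only [comm, mul_sub, sub_mul, tr_sub]
  rw [← mul_assoc, ← mul_assoc, tr_mul_comm (P * B) A, ← mul_assoc]

/-- `ω` is well-defined and real. -/
theorem omega_eq (κ : ℝ) (p : ProjSpace H) (u v : TangentSpace 𝓘(ℝ, ModelE H) p)
    (A B : selfAdjoint (H →L[ℂ] H)) (hA : tangentOp p u = -Complex.I • (comm (A : H →L[ℂ] H) p.op))
    (hB : tangentOp p v = -Complex.I • (comm (B : H →L[ℂ] H) p.op)) :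
    (omega κ p u v : ℂ) = -Complex.I * κ * tr (p.op * (comm (A : H →L[ℂ] H) (B : H →L[ℂ] H))) := by
  have e : ∀ {A B : H →L[ℂ] H}, -Complex.I • (comm A p.op) = -Complex.I • (comm B p.op) →
      (comm A p.op) = (comm B p.op) := fun h => smul_right_injective _ (neg_ne_zero.2 Complex.I_ne_zero) h
  have eA := e (hA.symm.trans (tangentOp_eq p u))
  have eB := e (hB.symm.trans (tangentOp_eq p v))
  have key : tr (p.op * (comm (generator p u : H →L[ℂ] H) (generator p v : H →L[ℂ] H))) =
      tr (p.op * (comm (A : H →L[ℂ] H) (B : H →L[ℂ] H))) := by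
    rw [tr_comm, ← comm_skew, ← eA, comm_skew, ← tr_comm, ← comm_skew (A : H →L[ℂ] H),
      ← comm_skew (A : H →L[ℂ] H), mul_neg, mul_neg, tr_neg, tr_neg, tr_comm, tr_comm, ← comm_skew p.op, ← eB,
      ← comm_skew p.op (B : H →L[ℂ] H)]
  rw [omega, key]
  apply Complex.ext
  · simp
  have h1 : (starRingEnd ℂ) (tr (p.op * (comm (A : H →L[ℂ] H) (B : H →L[ℂ] H)))) =
      - tr (p.op * (comm (A : H →L[ℂ] H) (B : H →L[ℂ] H))) := by
    rw [← tr_star, star_mul, val_selfAdj, tr_mul_comm]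
    simp only [comm, star_sub, star_mul, selfAdjoint.star_val_eq, mul_sub, tr_sub]
    ring
  have h2 := congrArg Complex.re h1
  simp at h2
  have h3 : (tr (p.op * (comm (A : H →L[ℂ] H) (B : H →L[ℂ] H)))).re = 0 := by linarith
  simp [h3]

/-- Conversely, every operator `-i[A, p]` with `A` self-adjoint is a tangent vector at `p`. -/
theorem exists_tangent (p : ProjSpace H) (A : selfAdjoint (H →L[ℂ] H)) :
    ∃ u : TangentSpace 𝓘(ℝ, ModelE H) p, tangentOp p u = -Complex.I • (comm (A : H →L[ℂ] H) p.op) := by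
  obtain ⟨ψ, h1, hp⟩ := p.isPure
  let φ : ℝ → H := fun t => ψ + t • (-Complex.I • (A : H →L[ℂ] H) ψ)
  have hA : ∀ x y, ⟪(A : H →L[ℂ] H) x, y⟫_ℂ = ⟪x, (A : H →L[ℂ] H) y⟫_ℂ := by
    intro x y
    conv_rhs => rw [← selfAdjoint.star_val_eq, ContinuousLinearMap.star_eq_adjoint,
      ContinuousLinearMap.adjoint_inner_right]
  have hφn : ∀ t, ‖φ t‖ ^ 2 = 1 + t ^ 2 * ‖(A : H →L[ℂ] H) ψ‖ ^ 2 := by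
    intro t
    have h2 : (⟪ψ, (A : H →L[ℂ] H) ψ⟫_ℂ).im = 0 := by
      have := inner_conj_symm (𝕜 := ℂ) ψ ((A : H →L[ℂ] H) ψ)
      rw [hA] at this
      exact Complex.conj_eq_iff_im.1 this
    rw [show φ t = ψ + t • (-Complex.I • (A : H →L[ℂ] H) ψ) from rfl, norm_add_sq (𝕜 := ℂ) (E := H), h1]
    simp [norm_smul, inner_smul_right, ← Complex.coe_smul, h2, mul_pow]
  have hφ0 : ∀ t, φ t ≠ 0 := by
    intro t h
    have := hφn t
    rw [h] at this
    have : 0 ≤ t ^ 2 * ‖(A : H →L[ℂ] H) ψ‖ ^ 2 := by positivity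
    simp at *
    linarith
  let q : ℝ → ProjSpace H := fun t => ⟨ray (φ t), ray_mem _ (hφ0 t)⟩
  have hq0 : q 0 = p := ProjSpace.ext (by simp [q, φ, ray_unit ψ h1, hp])
  have hφd : HasDerivAt φ (-Complex.I • (A : H →L[ℂ] H) ψ) 0 := by
    simpa [φ] using ((hasDerivAt_id (0 : ℝ)).smul_const (-Complex.I • (A : H →L[ℂ] H) ψ)).const_add ψ
  have hd : HasDerivAt (fun t => (q t).op) (-Complex.I • (comm (A : H →L[ℂ] H) p.op)) 0 := by
    have hn : HasDerivAt (fun t => (‖φ t‖ ^ 2)⁻¹) 0 0 := by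
      simp_rw [hφn]
      have : HasDerivAt (fun t : ℝ => 1 + t ^ 2 * ‖(A : H →L[ℂ] H) ψ‖ ^ 2) 0 0 := by
        simpa using (((hasDerivAt_id (0 : ℝ)).pow 2).mul_const (‖(A : H →L[ℂ] H) ψ‖ ^ 2)).const_add 1
      have h := this.inv (by simp)
      rw [neg_zero, zero_div] at h
      exact h
    have hr : HasDerivAt (fun t => InnerProductSpace.rankOne ℂ (φ t) (φ t))
        (InnerProductSpace.rankOne ℂ ψ (-Complex.I • (A : H →L[ℂ] H) ψ) +
          InnerProductSpace.rankOne ℂ (-Complex.I • (A : H →L[ℂ] H) ψ) ψ) 0 := by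
      have := (isBoundedBilinear_rankOne (H := H)).hasFDerivAt (φ 0, φ 0) |>.comp_hasDerivAt 0
        (hφd.prodMk hφd)
      refine this.congr_deriv ?_
      simp [φ, IsBoundedBilinearMap.deriv]
    have := hn.smul hr
    refine this.congr_deriv ?_
    rw [hp]
    ext x
    simp [h1, comm, hA, φ]
    module
  have hqc : Continuous q := by
    have : Continuous φ := by fun_prop
    refine continuous_induced_rng.2 ?_
    refine Continuous.smul ((this.norm.pow 2).inv₀ fun t => by simp [hφ0]) ?_
    exact (isBoundedBilinear_rankOne (H := H)).continuous.comp (this.prodMk this)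
  have hqd : MDifferentiableAt 𝓘(ℝ, ℝ) 𝓘(ℝ, ModelE H) q 0 := by
    rw [mdifferentiableAt_iff_target]
    refine ⟨hqc.continuousAt, ?_⟩
    have := (contDiffAt_ambientChart _ (q 0).op
      (exists_mem_affChart_source (q 0)).choose_spec).differentiableAt (by simp)
    exact (this.comp 0 hd.differentiableAt).mdifferentiableAt
  rw [← hq0]
  refine ⟨mfderiv 𝓘(ℝ, ℝ) 𝓘(ℝ, ModelE H) q 0 (1 : ℝ), ?_⟩
  have h4 := HasMFDerivAt.comp 0 (mdiff_val (q 0)).hasMFDerivAt hqd.hasMFDerivAt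
  have h5 := hd.hasFDerivAt.hasMFDerivAt
  have h6 := congrArg (fun L => L (1 : ℝ)) (hasMFDerivAt_unique h4 h5)
  refine h6.trans ?_
  rw [hq0]
  exact one_smul ℝ _

theorem omega_nondegenerate (κ : ℝ) (hκ : κ ≠ 0) (p : ProjSpace H)
    (u : TangentSpace 𝓘(ℝ, ModelE H) p) (h : ∀ v, omega κ p u v = 0) : u = 0 := by
  obtain ⟨A, hA⟩ := exists_generator p u
  let C : H →L[ℂ] H := (comm (A : H →L[ℂ] H) p.op)
  have hC : star C = -C := by
    simp [C, comm, val_selfAdj]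
  let B : selfAdjoint (H →L[ℂ] H) := ⟨Complex.I • C, by
    rw [selfAdjoint.mem_iff, star_smul, hC]; simp⟩
  obtain ⟨v, hv⟩ := exists_tangent p B
  have h1 := omega_eq κ p u v A B hA hv
  rw [h v, tr_comm, ← comm_skew] at h1
  have h2 : -C * (Complex.I • C) = Complex.I • (star C * C) := by rw [hC]; simp
  have h3 : (0:ℂ) = κ * tr (star C * C) := by
    have := h1
    change ((0:ℝ):ℂ) = -Complex.I * κ * tr (-C * (Complex.I • C)) at this
    rw [h2, tr_smul] at this
    rw [← Complex.ofReal_zero, this]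
    linear_combination (-(κ : ℂ) * tr (star C * C)) * Complex.I_mul_I
  have h4 : tr (star C * C) = 0 := by
    simpa [hκ] using h3.symm
  have h5 : C = 0 := tr_star_mul_self C (by simp [h4])
  apply tangentOp_injective p
  rw [hA, map_zero]
  change -Complex.I • C = 0
  simp [h5]

/-- `ω_p` induces an isomorphism of the tangent space onto its dual. -/
theorem existsUnique_hamiltonian (κ : ℝ) (hκ : κ ≠ 0) (p : ProjSpace H)
    (l : TangentSpace 𝓘(ℝ, ModelE H) p →ₗ[ℝ] ℝ) :
    ∃! X : TangentSpace 𝓘(ℝ, ModelE H) p, ∀ v, omega κ p X v = l v := by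
  have hadd : ∀ u v A B, tangentOp p u = -Complex.I • (comm (A : H →L[ℂ] H) p.op) →
    tangentOp p v = -Complex.I • (comm (B : H →L[ℂ] H) p.op) →
    tangentOp p (u + v) = -Complex.I • (comm (A + B : H →L[ℂ] H) p.op) := by
    intro u v A B h1 h2; rw [map_add, h1, h2, ← smul_add]; congr 1; simp only [comm]; noncomm_ring
  have hsm : ∀ (c : ℝ) u A, tangentOp p u = -Complex.I • (comm (A : H →L[ℂ] H) p.op) →
    tangentOp p (c • u) = -Complex.I • (comm (c • A : H →L[ℂ] H) p.op) := by
    intro c u A h1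
    rw [map_smul, h1, smul_comm]; simp [comm, smul_sub]
  let W : TangentSpace 𝓘(ℝ, ModelE H) p →ₗ[ℝ] Module.Dual ℝ (TangentSpace 𝓘(ℝ, ModelE H) p) :=
    LinearMap.mk₂ ℝ (omega κ p)
    (by
      intro u u' v
      apply Complex.ofReal_injective
      rw [omega_eq κ p _ _ (generator p u + generator p u') (generator p v)
        (hadd _ _ _ _ (tangentOp_eq p u) (tangentOp_eq p u')) (tangentOp_eq p v), Complex.ofReal_add,
        omega_eq κ p _ _ _ _ (tangentOp_eq p u) (tangentOp_eq p v),
        omega_eq κ p _ _ _ _ (tangentOp_eq p u') (tangentOp_eq p v)]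
      simp only [AddSubgroup.coe_add, comm, mul_add, add_mul, mul_sub, tr_add, tr_sub]; ring)
    (by
      intro c u v
      apply Complex.ofReal_injective
      rw [omega_eq κ p _ _ (c • generator p u) (generator p v)
        (hsm _ _ _ (tangentOp_eq p u)) (tangentOp_eq p v), smul_eq_mul, Complex.ofReal_mul,
        omega_eq κ p _ _ _ _ (tangentOp_eq p u) (tangentOp_eq p v)]
      simp only [selfAdjoint.val_smul, comm, smul_mul_assoc, mul_smul_comm, ← smul_sub]
      rw [← Complex.coe_smul, tr_smul]
      ring)
    (by
      intro v u u'
      apply Complex.ofReal_injective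
      rw [omega_eq κ p _ _ (generator p v) (generator p u + generator p u')
        (tangentOp_eq p v) (hadd _ _ _ _ (tangentOp_eq p u) (tangentOp_eq p u')), Complex.ofReal_add,
        omega_eq κ p _ _ _ _ (tangentOp_eq p v) (tangentOp_eq p u),
        omega_eq κ p _ _ _ _ (tangentOp_eq p v) (tangentOp_eq p u')]
      simp only [AddSubgroup.coe_add, comm, mul_add, add_mul, mul_sub, tr_add, tr_sub]; ring)
    (by
      intro c v u
      apply Complex.ofReal_injective
      rw [omega_eq κ p _ _ (generator p v) (c • generator p u)
        (tangentOp_eq p v) (hsm _ _ _ (tangentOp_eq p u)), smul_eq_mul, Complex.ofReal_mul,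
        omega_eq κ p _ _ _ _ (tangentOp_eq p v) (tangentOp_eq p u)]
      simp only [selfAdjoint.val_smul, comm, smul_mul_assoc, mul_smul_comm, ← smul_sub]
      rw [← Complex.coe_smul, tr_smul]
      ring)
  have hinj : Function.Injective W := by
    rw [← LinearMap.ker_eq_bot, LinearMap.ker_eq_bot']
    intro u hu
    exact omega_nondegenerate κ hκ p u fun v => LinearMap.congr_fun hu v
  have : FiniteDimensional ℝ (TangentSpace 𝓘(ℝ, ModelE H) p) :=
    inferInstanceAs (FiniteDimensional ℝ (ModelE H))
  have hsurj : Function.Surjective W :=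
    (LinearMap.injective_iff_surjective_of_finrank_eq_finrank
      (Subspace.dual_finrank_eq).symm).1 hinj
  obtain ⟨X, hX⟩ := hsurj l
  refine ⟨X, fun v => LinearMap.congr_fun hX v, fun Y hY => hinj ?_⟩
  rw [hX]
  exact LinearMap.ext hY


/-- The Hamiltonian vector field `X_f`: the unique one with `ω_p(X_f(p), ·) = df_p` for all `p`. -/
def hamiltonianField (κ : ℝ) (hκ : 0 < κ) (f : ProjSpace H → ℝ) (p : ProjSpace H) :
    TangentSpace 𝓘(ℝ, ModelE H) p :=
  (existsUnique_hamiltonian κ hκ.ne' p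
    (show TangentSpace 𝓘(ℝ, ModelE H) p →L[ℝ] ℝ from
      mfderiv 𝓘(ℝ, ModelE H) 𝓘(ℝ, ℝ) f p).toLinearMap).choose

lemma hamiltonianField_spec (κ : ℝ) (hκ : 0 < κ) (f : ProjSpace H → ℝ) (p : ProjSpace H)
    (v : TangentSpace 𝓘(ℝ, ModelE H) p) :
    omega κ p (hamiltonianField κ hκ f p) v = mfderiv 𝓘(ℝ, ModelE H) 𝓘(ℝ, ℝ) f p v :=
  (existsUnique_hamiltonian κ hκ.ne' p _).choose_spec.1 v

/-! ### The requirements on the inverse quantization map `𝒪 : A ↦ f_A` -/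

/-- The action `Φ_U(p) = U p U⁻¹` of the unitary group. -/
def unitaryAct (U : unitary (H →L[ℂ] H)) (p : ProjSpace H) : ProjSpace H where
  op := (U : H →L[ℂ] H) * p.op * ((U⁻¹ : unitary (H →L[ℂ] H)) : H →L[ℂ] H)
  isPure := by
    obtain ⟨ψ, h1, hp⟩ := p.isPure
    refine ⟨(U : H →L[ℂ] H) ψ, ?_, ?_⟩
    · rw [← h1]
      exact (Unitary.linearIsometryEquiv U).norm_map ψ
    · ext x
      simp [hp, ← Unitary.star_eq_inv, ContinuousLinearMap.star_eq_adjoint,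
        ContinuousLinearMap.adjoint_inner_right]

/-- The self-adjoint operator `U⁻¹ A U`. -/
def unitaryConj (U : unitary (H →L[ℂ] H)) (A : selfAdjoint (H →L[ℂ] H)) :
    selfAdjoint (H →L[ℂ] H) :=
  ⟨((U⁻¹ : unitary (H →L[ℂ] H)) : H →L[ℂ] H) * A * U, by
    rw [selfAdjoint.mem_iff]
    simp [mul_assoc, ← Unitary.star_eq_inv]⟩

/-- `𝒪` is injective. -/
def ReqInjective (O : selfAdjoint (H →L[ℂ] H) → ProjSpace H → ℝ) : Prop := Function.Injective O

/-- `𝒪` is `ℝ`-linear. -/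
def ReqLinear (O : selfAdjoint (H →L[ℂ] H) → ProjSpace H → ℝ) : Prop := IsLinearMap ℝ O

/-- For every self-adjoint `K` (the Hamiltonian), `f_K` is `C¹`, and a curve `p(t)`, `t ∈ (a, b)`,
satisfies Hamilton's equation `dp/dt = X_{f_K}(p(t))` on the manifold if and only if it satisfies
Schrödinger's equation `dp/dt = -i[K, p(t)]`. The values of `γ` outside `(a, b)` are irrelevant. -/
def ReqDynamics (κ : ℝ) (hκ : 0 < κ) (O : selfAdjoint (H →L[ℂ] H) → ProjSpace H → ℝ) : Prop :=
  ∀ K : selfAdjoint (H →L[ℂ] H),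
    ContMDiff 𝓘(ℝ, ModelE H) 𝓘(ℝ, ℝ) 1 (O K) ∧
    ∀ (a b : ℝ) (γ : ℝ → ProjSpace H),
      IsMIntegralCurveOn (I := 𝓘(ℝ, ModelE H)) γ (hamiltonianField κ hκ (O K)) (Set.Ioo a b) ↔
      ∀ t ∈ Set.Ioo a b,
        HasDerivAt (fun s => (γ s).op) (-Complex.I • comm (K : H →L[ℂ] H) (γ t).op) t

/-- `𝒪` is `U(n)`-covariant: `f_A(Φ_U(p)) = f_{U⁻¹AU}(p)`. -/
def ReqCovariant (O : selfAdjoint (H →L[ℂ] H) → ProjSpace H → ℝ) : Prop :=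
  ∀ (A : selfAdjoint (H →L[ℂ] H)) (U : unitary (H →L[ℂ] H)) (p : ProjSpace H),
    O A (unitaryAct U p) = O (unitaryConj U A) p

/-! ### Square-integrable frame functions -/

/-- The Hilbert-Schmidt distance `d₂(p, q) = ‖p - q‖₂`, `‖A‖₂² = tr(A*A)`. -/
def hsDist (p q : ProjSpace H) : ℝ := √(tr (star (p.op - q.op) * (p.op - q.op))).re

/-- A basis of the projective space: a maximal set of points with mutual distance `√2` (equivalently,
the set of lines of some Hilbert basis of `H`). -/
def IsProjBasis (N : Set (ProjSpace H)) : Prop :=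
  Maximal (fun N' : Set (ProjSpace H) => ∀ p ∈ N', ∀ q ∈ N', p ≠ q → hsDist p q = √2) N

/-- Frame functions: `∑ F(x_i)` has the same value `W` for all bases `{x_1, …, x_n}` of the projective
space. -/
def IsFrameFunction (F : ProjSpace H → ℂ) : Prop :=
  ∃ W : ℂ, ∀ x : Fin (finrank ℂ H) → ProjSpace H, Function.Injective x → IsProjBasis (Set.range x) →
    ∑ i, F (x i) = W

/-- The Borel σ-algebra. -/
instance : MeasurableSpace (ProjSpace H) := borel _
instance : BorelSpace (ProjSpace H) := ⟨rfl⟩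

/-- The projection `π : ψ ↦ [ψ]` of the unit sphere onto the projective space. -/
def sphereProj (ψ : Metric.sphere (0 : H) 1) : ProjSpace H :=
  ⟨InnerProductSpace.rankOne ℂ (ψ : H) (ψ : H), ψ, by simp, rfl⟩

/-- The unitarily invariant Borel probability measure `ν` on the unit sphere of `H`, as the normalized
surface measure. -/
def sphereMeasure (H : Type*) [NormedAddCommGroup H] [InnerProductSpace ℂ H]
    [FiniteDimensional ℂ H] [MeasurableSpace H] [BorelSpace H] :
    Measure (Metric.sphere (0 : H) 1) :=
  letI : InnerProductSpace ℝ H := InnerProductSpace.complexToReal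
  ((volume : Measure H).toSphere Set.univ)⁻¹ • (volume : Measure H).toSphere

/-- The unitarily invariant Borel probability measure `μ = π_* ν` on the projective space (the
normalized Liouville measure). -/
def projMeasure (H : Type*) [NormedAddCommGroup H] [InnerProductSpace ℂ H]
    [FiniteDimensional ℂ H] [MeasurableSpace H] [BorelSpace H] : Measure (ProjSpace H) :=
  (sphereMeasure H).map sphereProj

/-- The space `ℱ²(H)` of the frame functions in `ℒ²(μ)` (functions, not classes). -/
def frameL2 (H : Type*) [NormedAddCommGroup H] [InnerProductSpace ℂ H]
    [FiniteDimensional ℂ H] [CompleteSpace H] [MeasurableSpace H] [BorelSpace H] :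
    Set (ProjSpace H → ℂ) :=
  {F | MemLp F 2 (projMeasure H) ∧ IsFrameFunction F}

end QuantumProj

end

open QuantumProj

/-!
The observables `κ tr (p A)` solve the dynamical requirement because the operator `-i[A, p]` is the
symplectic gradient of `p ↦ κ tr (p A)` at `p` (`omega_eq_reTrMul`), and because the inclusion of the
projective space into the operators turns Hamilton's equation into an equation for curves of operators
(`hasMFDerivAt_curve_iff`). Conversely, the solutions of Schrödinger's equation through every point
determine the differential of `f_A`, so that `f_A` differs from `κ tr (p A)` by a constant
(`eq_of_mfderiv_eq_zero`). That constant is linear in `A` and unitarily invariant, hence a multiple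
`c tr A` of the trace by the spectral theorem (`exists_eq_mul_tr`). Summing `f_A` over a basis gives
`(κ + n c) tr A`, so injectivity means `κ + n c ≠ 0`. The same formula, read for all operators, is the
complex-linear extension, and its image consists of all functions `p ↦ tr (p T)`.

What remains is a form of Gleason's theorem: in dimension `n > 2` a square-integrable frame function
is `p ↦ tr (p T)` at *every* point (`IsVectorFrame.exists_quadratic`). The proof regards a frame
function as a function `f` of vectors, constant on complex lines, and rests on one mean value identity,
`IsVectorFrame.integrable_orthogonal_and_integral`. For unit vectors `p` and `w ⊥ p`, the point
`x = a u p + r w` (`a, r > 0`, `|u| = 1`) and the orthogonal point `-r u p + a w` of the same plane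
satisfy `f x + f (-r u p + a w) = f p + f w`. In polar coordinates on `ℂ p` and on `p^⊥` the measure
`|⟪p, x⟫| ^ (2n - 4) exp (-‖x‖²) dx` is symmetric under the exchange of `a` and `r`, so
integrating the relation yields
`∫ f(x) |⟪p, x⟫| ^ (2n - 4) exp (-‖x‖²) dx = (M / 2) (f p + mean of f over the unit sphere of p^⊥)`,
with `M` the total mass of the measure, together with the integrability of `f` over the unit sphere of
`p^⊥`. For `n = 2` this shows that the mean of `f` is `W / 2`. For `n = 3` the left-hand side is a
quadratic form in `p` and the mean over `p^⊥` is `(W - f p) / 2`, so that `f` is a quadratic form. For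
`n > 3`, by induction, the restrictions of `f` to all hyperplanes are quadratic forms, and polarization
glues them (`IsVectorFrame.exists_quadratic_of_hyperplanes`), since any three vectors lie in a
hyperplane.
-/

open QuantumProj MeasureTheory Module
open scoped InnerProductSpace ENNReal NNReal Pointwise Manifold ContDiff

/-! ### Gaussian measures in polar coordinates -/

/-- The finite measure `r ^ k * exp (-r ^ 2) dr` on the half-line `(0, ∞)`. -/
noncomputable def gaussPow (k : ℕ) : Measure (Set.Ioi (0 : ℝ)) :=
  (Measure.volumeIoiPow k).withDensity fun r => ENNReal.ofReal (Real.exp (-(r : ℝ) ^ 2))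

lemma MeasureTheory.MeasurePreserving.withDensity_comp {α β : Type*} [MeasurableSpace α]
    [MeasurableSpace β] {μ : Measure α} {ν : Measure β} {e : α → β} (he : MeasurePreserving e μ ν)
    {g : β → ℝ≥0∞} (hg : Measurable g) :
    MeasurePreserving e (μ.withDensity (g ∘ e)) (ν.withDensity g) := by
  refine ⟨he.measurable, ?_⟩
  ext s hs
  rw [Measure.map_apply he.measurable hs, withDensity_apply _ (he.measurable hs),
    withDensity_apply _ hs, ← he.setLIntegral_comp_preimage hs hg]
  rfl

lemma measurePreserving_exchange {α β γ : Type*} [MeasurableSpace α] [MeasurableSpace β]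
    [MeasurableSpace γ] (μ : Measure α) (θ : Measure β) (σ : Measure γ) [SFinite μ] [SFinite θ]
    [SFinite σ] : MeasurePreserving
      (fun x : (α × β) × (γ × β) => ((x.1.1, x.2.2), (x.2.1, x.1.2)))
      ((μ.prod θ).prod (σ.prod θ)) ((μ.prod θ).prod (σ.prod θ)) := by
  have s1 := (MeasurePreserving.id (μ.prod θ)).prod
    (Measure.measurePreserving_swap (μ := σ) (ν := θ))
  have s2 := measurePreserving_prodAssoc μ θ (θ.prod σ)
  have s3 := (MeasurePreserving.id μ).prod
    ((measurePreserving_prodAssoc θ θ σ).symm MeasurableEquiv.prodAssoc)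
  have s4 := (MeasurePreserving.id μ).prod
    ((Measure.measurePreserving_swap (μ := θ) (ν := θ)).prod (MeasurePreserving.id σ))
  have s5 := (MeasurePreserving.id μ).prod (measurePreserving_prodAssoc θ θ σ)
  have s6 := s2.symm MeasurableEquiv.prodAssoc
  have s7 := (MeasurePreserving.id (μ.prod θ)).prod
    (Measure.measurePreserving_swap (μ := θ) (ν := σ))
  exact s7.comp (s6.comp (s5.comp (s4.comp (s3.comp (s2.comp s1)))))

instance (k : ℕ) : SigmaFinite (gaussPow k) := by
  unfold gaussPow
  exact SigmaFinite.withDensity_ofReal _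

lemma volumeIoiPow_withDensity (m k : ℕ) :
    (Measure.volumeIoiPow m).withDensity
      (fun r => ENNReal.ofReal ((r : ℝ) ^ k * Real.exp (-(r : ℝ) ^ 2))) = gaussPow (m + k) := by
  have h1 : Measurable fun r : Set.Ioi (0 : ℝ) => ENNReal.ofReal ((r : ℝ) ^ m) := by fun_prop
  have h2 : Measurable fun r : Set.Ioi (0 : ℝ) =>
    ENNReal.ofReal ((r : ℝ) ^ k * Real.exp (-(r : ℝ) ^ 2)) := by fun_prop
  have h3 : Measurable fun r : Set.Ioi (0 : ℝ) => ENNReal.ofReal ((r : ℝ) ^ (m + k)) := by fun_prop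
  have h4 : Measurable fun r : Set.Ioi (0 : ℝ) =>
    ENNReal.ofReal (Real.exp (-(r : ℝ) ^ 2)) := by fun_prop
  rw [gaussPow, Measure.volumeIoiPow, Measure.volumeIoiPow, ← withDensity_mul _ h1 h2,
    ← withDensity_mul _ h3 h4]
  congr 1
  funext r
  have hr : (0 : ℝ) ≤ r := r.2.out.le
  simp only [Pi.mul_apply]
  rw [← ENNReal.ofReal_mul (by positivity), ← ENNReal.ofReal_mul (by positivity)]
  congr 1
  ring

instance (k : ℕ) : IsFiniteMeasure (gaussPow k) := by
  have h3 : Measurable fun r : Set.Ioi (0 : ℝ) => ENNReal.ofReal ((r : ℝ) ^ k) := by fun_prop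
  have h4 : Measurable fun r : Set.Ioi (0 : ℝ) =>
    ENNReal.ofReal (Real.exp (-(r : ℝ) ^ 2)) := by fun_prop
  refine ⟨?_⟩
  rw [gaussPow, Measure.volumeIoiPow, ← withDensity_mul _ h3 h4, withDensity_apply _ .univ,
    Measure.restrict_univ]
  have key : Integrable (fun r : ℝ => r ^ k * Real.exp (-r ^ 2)) := by
    simpa using integrable_rpow_mul_exp_neg_mul_sq (b := 1) one_pos (s := k)
      (by have : (0 : ℝ) ≤ k := by positivity
          linarith)
  have key2 := (integrableOn_iff_comap_subtypeVal measurableSet_Ioi).1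
    (key.integrableOn (s := Set.Ioi (0 : ℝ)))
  refine lt_of_le_of_lt (lintegral_mono fun r => ?_) key2.2
  have hr : (0 : ℝ) ≤ r := r.2.out.le
  simp only [Pi.mul_apply, Function.comp]
  rw [← ENNReal.ofReal_mul (by positivity), Real.enorm_eq_ofReal (by positivity)]

lemma gaussPow_ne_zero (k : ℕ) : gaussPow k ≠ 0 := by
  have h4 : Measurable fun r : Set.Ioi (0 : ℝ) =>
    ENNReal.ofReal (Real.exp (-(r : ℝ) ^ 2)) := by fun_prop
  rw [gaussPow, Ne, withDensity_eq_zero_iff h4.aemeasurable]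
  intro h
  have h0 : ∀ᵐ r ∂(Measure.volumeIoiPow k), False := by
    filter_upwards [h] with r hr
    have : 0 < ENNReal.ofReal (Real.exp (-(r : ℝ) ^ 2)) := by
      rw [ENNReal.ofReal_pos]; positivity
    exact this.ne' hr
  rw [Filter.eventually_false_iff_eq_bot, ae_eq_bot] at h0
  have := Measure.volumeIoiPow_apply_Iio k ⟨1, by simp⟩
  rw [h0] at this
  simp at this
  have h5 : (0 : ℝ) < (k + 1 : ℝ)⁻¹ := by positivity
  linarith

section Polar

variable {E : Type*} [NormedAddCommGroup E] [NormedSpace ℝ E] [FiniteDimensional ℝ E]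
  [MeasurableSpace E] [BorelSpace E] (ν : Measure E) [ν.IsAddHaarMeasure]

/-- The measure `‖x‖ ^ k * exp (-‖x‖ ^ 2) dν`. -/
noncomputable def radialGauss (k : ℕ) : Measure E :=
  ν.withDensity fun x => ENNReal.ofReal (‖x‖ ^ k * Real.exp (-‖x‖ ^ 2))

/-- Polar coordinates: the radial Gaussian measure is the product of the surface measure of the unit
sphere and of a measure on the half-line. -/
lemma measurePreserving_polar [Nontrivial E] (k : ℕ) :
    MeasurePreserving (fun x : Metric.sphere (0 : E) 1 × Set.Ioi (0 : ℝ) => (x.2 : ℝ) • (x.1 : E))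
      (ν.toSphere.prod (gaussPow (finrank ℝ E - 1 + k))) (radialGauss ν k) := by
  have h1 := (ν.measurePreserving_homeomorphUnitSphereProd).symm
    (homeomorphUnitSphereProd E).toMeasurableEquiv
  have h2 : MeasurePreserving (Subtype.val : ({0}ᶜ : Set E) → E) (ν.comap (↑)) ν := by
    refine ⟨measurable_subtype_coe, ?_⟩
    rw [map_comap_subtype_coe (measurableSet_singleton _).compl, restrict_compl_singleton]
  have h3 := h2.comp h1
  have hg : Measurable fun x : E => ENNReal.ofReal (‖x‖ ^ k * Real.exp (-‖x‖ ^ 2)) := by fun_prop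
  have h4 := h3.withDensity_comp hg
  have h5 : Measurable fun r : Set.Ioi (0 : ℝ) =>
    ENNReal.ofReal ((r : ℝ) ^ k * Real.exp (-(r : ℝ) ^ 2)) := by fun_prop
  have h6 : ν.toSphere.prod (gaussPow (finrank ℝ E - 1 + k)) =
      (ν.toSphere.prod (.volumeIoiPow (finrank ℝ E - 1))).withDensity
      ((fun x : E => ENNReal.ofReal (‖x‖ ^ k * Real.exp (-‖x‖ ^ 2))) ∘ Subtype.val ∘
        (homeomorphUnitSphereProd E).toMeasurableEquiv.symm) := by
    rw [← volumeIoiPow_withDensity, prod_withDensity_right h5]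
    congr 1
    funext x
    have : ‖((homeomorphUnitSphereProd E).symm x : E)‖ = (x.2 : ℝ) := by
      rw [homeomorphUnitSphereProd_symm_apply_coe, norm_smul]
      simp [abs_of_pos x.2.2.out]
    show _ = ENNReal.ofReal (‖((homeomorphUnitSphereProd E).symm x : E)‖ ^ k *
      Real.exp (-‖((homeomorphUnitSphereProd E).symm x : E)‖ ^ 2))
    rw [this]
  have h7 : (fun x : Metric.sphere (0 : E) 1 × Set.Ioi (0 : ℝ) => (x.2 : ℝ) • (x.1 : E)) =
      Subtype.val ∘ (homeomorphUnitSphereProd E).toMeasurableEquiv.symm := by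
    funext x
    exact (homeomorphUnitSphereProd_symm_apply_coe E x).symm
  rw [h6, h7]
  exact h4

omit [FiniteDimensional ℝ E] in
lemma measurableEmbedding_polar : MeasurableEmbedding
    (fun x : Metric.sphere (0 : E) 1 × Set.Ioi (0 : ℝ) => (x.2 : ℝ) • (x.1 : E)) := by
  have h7 : (fun x : Metric.sphere (0 : E) 1 × Set.Ioi (0 : ℝ) => (x.2 : ℝ) • (x.1 : E)) =
      Subtype.val ∘ (homeomorphUnitSphereProd E).symm := by
    funext x
    exact (homeomorphUnitSphereProd_symm_apply_coe E x).symm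
  rw [h7]
  exact (MeasurableEmbedding.subtype_coe (measurableSet_singleton _).compl).comp
    (homeomorphUnitSphereProd E).symm.measurableEmbedding

lemma toSphere_measurePreserving_neg :
    MeasurePreserving (fun u : Metric.sphere (0 : E) 1 => -u) ν.toSphere ν.toSphere := by
  have hm : Measurable (fun u : Metric.sphere (0 : E) 1 => -u) := continuous_neg.measurable
  refine ⟨hm, ?_⟩
  ext s hs
  rw [Measure.map_apply hm hs, Measure.toSphere_apply' _ hs, Measure.toSphere_apply' _ (hm hs),
    ← Measure.measure_neg ν (Set.Ioo (0 : ℝ) 1 • ((↑) '' s : Set E))]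
  congr 2
  ext x
  simp only [Set.mem_smul, Set.mem_neg, Set.mem_image, Set.mem_preimage]
  constructor
  · rintro ⟨r, hr, _, ⟨u, hu, rfl⟩, rfl⟩
    exact ⟨r, hr, _, ⟨-u, hu, rfl⟩, by simp⟩
  · rintro ⟨r, hr, _, ⟨u, hu, rfl⟩, h⟩
    exact ⟨r, hr, _, ⟨-u, by simpa using hu, rfl⟩, by simp [h]⟩

end Polar

/-! ### Frame functions on a Hilbert space -/

/-- Frame functions, as functions of vectors: `f` is constant on punctured complex lines and its
values at the vectors of any orthonormal basis add up to `W`. The value `f 0` is irrelevant. -/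
structure IsVectorFrame {H : Type*} [NormedAddCommGroup H] [InnerProductSpace ℂ H]
    (f : H → ℂ) (W : ℂ) : Prop where
  smul : ∀ c : ℂ, c ≠ 0 → ∀ x, f (c • x) = f x
  sum : ∀ b : OrthonormalBasis (Fin (finrank ℂ H)) ℂ H, ∑ i, f (b i) = W

lemma Orthonormal.sumElim' {𝕜 E ι κ : Type*} [RCLike 𝕜] [NormedAddCommGroup E]
    [InnerProductSpace 𝕜 E] {v : ι → E} {c : κ → E} (hv : Orthonormal 𝕜 v) (hc : Orthonormal 𝕜 c)
    (h : ∀ i j, ⟪v i, c j⟫_𝕜 = 0) : Orthonormal 𝕜 (Sum.elim v c) := by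
  refine ⟨?_, ?_⟩
  · rintro (i | i)
    exacts [hv.1 i, hc.1 i]
  · rintro (i | i) (j | j) hij
    · exact hv.2 fun e => hij (by rw [e])
    · exact h i j
    · exact inner_eq_zero_symm.1 (h j i)
    · exact hc.2 fun e => hij (by rw [e])

namespace IsVectorFrame

variable {H : Type*} [NormedAddCommGroup H] [InnerProductSpace ℂ H] [FiniteDimensional ℂ H]
  {f : H → ℂ} {W : ℂ}

lemma sum_orthonormal (hf : IsVectorFrame f W) {ι : Type*} [Fintype ι] {v : ι → H}
    (hv : Orthonormal ℂ v) (hcard : Fintype.card ι = finrank ℂ H) : ∑ i, f (v i) = W := by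
  have hspan := hv.linearIndependent.span_eq_top_of_card_eq_finrank' hcard
  let b := (OrthonormalBasis.mk hv hspan.ge).reindex (Fintype.equivFinOfCardEq hcard)
  rw [← hf.sum b, ← (Fintype.equivFinOfCardEq hcard).sum_comp]
  simp [b]

/-- The restriction of a frame function to a hyperplane is a frame function. -/
lemma restrict_orthogonal (hf : IsVectorFrame f W) {p : H} (hp : ‖p‖ = 1) :
    IsVectorFrame (fun w : (ℂ ∙ p)ᗮ => f w) (W - f p) := by
  refine ⟨fun a ha x => by simp [hf.smul a ha], fun b => ?_⟩
  have h1 : Orthonormal ℂ (fun _ : Unit => p) := ⟨fun _ => hp, fun i j h => (h rfl).elim⟩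
  have h2 : Orthonormal ℂ (fun i => (b i : H)) :=
    b.orthonormal.comp_linearIsometry (ℂ ∙ p)ᗮ.subtypeₗᵢ
  have h3 := h1.sumElim' h2 fun _ k =>
    (Submodule.mem_orthogonal_singleton_iff_inner_right (𝕜 := ℂ)).1 (b k).2
  have hp0 : p ≠ 0 := by rintro rfl; simp at hp
  have h4 := hf.sum_orthonormal h3 (by
    have := (ℂ ∙ p).finrank_add_finrank_orthogonal
    rw [finrank_span_singleton hp0] at this
    simpa using this)
  rw [← h4]
  simp

/-- Within a two-dimensional subspace, the sum over orthonormal pairs is constant. -/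
lemma add_eq_add (hf : IsVectorFrame f W) {p w : H} (hp : ‖p‖ = 1) (hw : ‖w‖ = 1)
    (hpw : ⟪p, w⟫_ℂ = 0) (α β : ℂ) (h0 : α ≠ 0) :
    f (α • p + β • w) + f (-(starRingEnd ℂ β) • p + starRingEnd ℂ α • w) = f p + f w := by
  let V : Submodule ℂ H := Submodule.span ℂ (Set.range ![p, w])
  let c := stdOrthonormalBasis ℂ Vᗮ
  have hwp : ⟪w, p⟫_ℂ = 0 := inner_eq_zero_symm.1 hpw
  have hpair : ∀ x y : H, ‖x‖ = 1 → ‖y‖ = 1 → ⟪x, y⟫_ℂ = 0 → Orthonormal ℂ ![x, y] := by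
    intro x y hx hy hxy
    rw [orthonormal_iff_ite]
    intro i j
    fin_cases i <;> fin_cases j <;> simp [hxy, inner_eq_zero_symm.1 hxy, hx, hy]
  have hV : finrank ℂ V = 2 := by
    simpa using finrank_span_eq_card (hpair p w hp hw hpw).linearIndependent
  have hpV : p ∈ V := Submodule.subset_span ⟨0, rfl⟩
  have hwV : w ∈ V := Submodule.subset_span ⟨1, rfl⟩
  have key : ∀ x ∈ V, ∀ y ∈ V, ‖x‖ = 1 → ‖y‖ = 1 → ⟪x, y⟫_ℂ = 0 →
      f x + f y = W - ∑ i, f (c i) := by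
    intro x hxV y hyV hx hy hxy
    have h2 : Orthonormal ℂ (fun i => (c i : H)) := c.orthonormal.comp_linearIsometry Vᗮ.subtypeₗᵢ
    have h3 := (hpair x y hx hy hxy).sumElim' h2 fun i k => by
      refine (Submodule.mem_orthogonal _ _).1 (c k).2 _ ?_
      fin_cases i
      exacts [hxV, hyV]
    have h4 := hf.sum_orthonormal h3 (by
      have := V.finrank_add_finrank_orthogonal
      simp; omega)
    rw [← h4]
    simp
  rw [key p hpV w hwV hp hw hpw]
  let N : ℝ := √(‖α‖ ^ 2 + ‖β‖ ^ 2)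
  have hα : 0 < ‖α‖ := by simpa using h0
  have hN : 0 < N := Real.sqrt_pos.2 (by positivity)
  have hN2 : N ^ 2 = ‖α‖ ^ 2 + ‖β‖ ^ 2 := Real.sq_sqrt (by positivity)
  have hnorm : ∀ a b : ℂ, ‖a‖ ^ 2 + ‖b‖ ^ 2 = N ^ 2 → ‖((N : ℂ)⁻¹) • (a • p + b • w)‖ = 1 := by
    intro a b hab
    have h5 : ‖a • p + b • w‖ ^ 2 = N ^ 2 := by
      rw [sq, norm_add_sq_eq_norm_sq_add_norm_sq_of_inner_eq_zero (𝕜 := ℂ) _ _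
        (by simp [inner_smul_left, inner_smul_right, hpw])]
      rw [norm_smul, norm_smul, hp, hw, ← hab]; ring
    have h6 : ‖a • p + b • w‖ = N := by
      rwa [sq_eq_sq₀ (norm_nonneg _) hN.le] at h5
    rw [norm_smul, h6]
    simp [abs_of_pos hN, hN.ne']
  have hNc : ((N : ℂ)⁻¹) ≠ 0 := by simpa using hN.ne'
  rw [← hf.smul _ hNc (α • p + β • w), ← hf.smul _ hNc (-(starRingEnd ℂ β) • p + _)]
  refine key _ ?_ _ ?_ ?_ ?_ ?_
  · exact V.smul_mem _ (V.add_mem (V.smul_mem _ hpV) (V.smul_mem _ hwV))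
  · exact V.smul_mem _ (V.add_mem (V.smul_mem _ hpV) (V.smul_mem _ hwV))
  · exact hnorm _ _ hN2.symm
  · refine hnorm _ _ ?_
    rw [hN2, norm_neg, RCLike.norm_conj, RCLike.norm_conj]; ring
  · simp only [inner_smul_left, inner_smul_right, inner_add_left, inner_add_right, hpw, hwp,
      inner_self_eq_norm_sq_to_K, hp, hw]
    simp
    ring_nf
    simp

/-- The form of `add_eq_add` in polar coordinates. -/
lemma add_eq_add_polar (hf : IsVectorFrame f W) {p w : H} (hp : ‖p‖ = 1) (hw : ‖w‖ = 1)
    (hpw : ⟪p, w⟫_ℂ = 0) {u : ℂ} (hu : ‖u‖ = 1) {a r : ℝ} (ha : 0 < a) :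
    f ((a • u) • p + r • w) + f ((r • -u) • p + a • w) = f p + f w := by
  have hu0 : u ≠ 0 := by rintro rfl; simp at hu
  rw [← hf.add_eq_add hp hw hpw (a • u) r (by simp [hu0, ha.ne'])]
  congr 1
  rw [← hf.smul u hu0 (-_ • p + _)]
  congr 1
  have : u * (starRingEnd ℂ) u = 1 := by
    rw [Complex.mul_conj, Complex.normSq_eq_norm_sq, hu]; simp
  rw [smul_add, smul_smul, smul_smul, ← Complex.coe_smul a w]
  congr 2
  · simp; ring
  · simp only [Complex.real_smul, map_mul, Complex.conj_ofReal]
    linear_combination (-a : ℂ) * this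

end IsVectorFrame

/-! ### The mean value identity -/

section OrthogonalDecomposition

variable {H : Type*} [NormedAddCommGroup H] [InnerProductSpace ℂ H] [FiniteDimensional ℂ H]

/-- The decomposition `H = ℂ p ⊕ p^⊥` for a unit vector `p`. -/
noncomputable def lineProdOrthogonal (p : H) (hp : ‖p‖ = 1) : (ℂ × (ℂ ∙ p)ᗮ) ≃L[ℝ] H :=
  let e : (ℂ × (ℂ ∙ p)ᗮ) ≃ₗ[ℂ] H :=
    { toFun := fun z => z.1 • p + (z.2 : H)
      map_add' := by intro x y; simp [add_smul]; abel
      map_smul' := by intro c x; simp [smul_smul]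
      invFun := fun x => (⟪p, x⟫_ℂ, ⟨x - ⟪p, x⟫_ℂ • p, by
        rw [Submodule.mem_orthogonal_singleton_iff_inner_right]
        simp [inner_sub_right, inner_smul_right, hp]⟩)
      left_inv := by
        rintro ⟨z, w, hw⟩
        rw [Submodule.mem_orthogonal_singleton_iff_inner_right] at hw
        simp [hp, hw]
      right_inv := by intro x; simp }
  (e.restrictScalars ℝ).toContinuousLinearEquiv

lemma lineProdOrthogonal_apply (p : H) (hp : ‖p‖ = 1) (z : ℂ × (ℂ ∙ p)ᗮ) :
    lineProdOrthogonal p hp z = z.1 • p + (z.2 : H) := rfl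

lemma inner_lineProdOrthogonal (p : H) (hp : ‖p‖ = 1) (z : ℂ × (ℂ ∙ p)ᗮ) :
    ⟪p, lineProdOrthogonal p hp z⟫_ℂ = z.1 := by
  have hw := (Submodule.mem_orthogonal_singleton_iff_inner_right (𝕜 := ℂ)).1 z.2.2
  simp [lineProdOrthogonal_apply, hp, hw]

lemma norm_sq_lineProdOrthogonal (p : H) (hp : ‖p‖ = 1) (z : ℂ × (ℂ ∙ p)ᗮ) :
    ‖lineProdOrthogonal p hp z‖ ^ 2 = ‖z.1‖ ^ 2 + ‖z.2‖ ^ 2 := by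
  have hw := (Submodule.mem_orthogonal_singleton_iff_inner_right (𝕜 := ℂ)).1 z.2.2
  rw [lineProdOrthogonal_apply, sq, norm_add_sq_eq_norm_sq_add_norm_sq_of_inner_eq_zero (𝕜 := ℂ) _ _
    (by simp [inner_smul_left, hw]), norm_smul, hp]
  simp [sq]

variable [MeasurableSpace H] [BorelSpace H]

/-- The measure `|⟪p, x⟫| ^ k * exp (-‖x‖ ^ 2) dν`. -/
noncomputable def axialGauss (ν : Measure H) (p : H) (k : ℕ) : Measure H :=
  ν.withDensity fun x => ENNReal.ofReal (‖⟪p, x⟫_ℂ‖ ^ k * Real.exp (-‖x‖ ^ 2))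

variable (ν : Measure H) [ν.IsAddHaarMeasure]

lemma exists_measurePreserving_lineProdOrthogonal (p : H) (hp : ‖p‖ = 1)
    (ν' : Measure (ℂ ∙ p)ᗮ) [ν'.IsAddHaarMeasure] (k : ℕ) : ∃ c : ℝ≥0∞, c ≠ 0 ∧ c ≠ ⊤ ∧
    MeasurePreserving (lineProdOrthogonal p hp)
      ((radialGauss (volume : Measure ℂ) k).prod (radialGauss ν' 0)) (c • axialGauss ν p k) := by
  have h1 := (lineProdOrthogonal p hp).isAddHaarMeasure_map ((volume : Measure ℂ).prod ν')
  set ρ := ((volume : Measure ℂ).prod ν').map (lineProdOrthogonal p hp) with hρ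
  have h2 := Measure.isAddLeftInvariant_eq_smul ρ ν
  have h3 := Measure.addHaarScalarFactor_pos_of_isAddHaarMeasure ρ ν
  set c := Measure.addHaarScalarFactor ρ ν
  refine ⟨c, by simpa using h3.ne', by simp, ?_⟩
  have h4 : MeasurePreserving (lineProdOrthogonal p hp) ((volume : Measure ℂ).prod ν')
      ((c : ℝ≥0∞) • ν) :=
    ⟨(lineProdOrthogonal p hp).continuous.measurable, by rw [← hρ, h2]; rfl⟩
  have hg : Measurable fun x : H =>
    ENNReal.ofReal (‖⟪p, x⟫_ℂ‖ ^ k * Real.exp (-‖x‖ ^ 2)) := by fun_prop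
  have h5 := h4.withDensity_comp hg
  rw [withDensity_smul_measure] at h5
  have h6 : Measurable fun z : ℂ => ENNReal.ofReal (‖z‖ ^ k * Real.exp (-‖z‖ ^ 2)) := by fun_prop
  have h7 : Measurable fun w : (ℂ ∙ p)ᗮ =>
    ENNReal.ofReal (‖w‖ ^ 0 * Real.exp (-‖w‖ ^ 2)) := by fun_prop
  rw [radialGauss, radialGauss, prod_withDensity h6 h7, axialGauss]
  convert h5 using 2
  funext z
  simp only [Function.comp]
  rw [inner_lineProdOrthogonal, norm_sq_lineProdOrthogonal, ← ENNReal.ofReal_mul (by positivity)]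
  congr 1
  rw [neg_add, Real.exp_add]
  ring

end OrthogonalDecomposition

namespace IsVectorFrame

variable {H : Type*} [NormedAddCommGroup H] [InnerProductSpace ℂ H] {f : H → ℂ} {W : ℂ}

lemma smul_real (hf : IsVectorFrame f W) {r : ℝ} (hr : 0 < r) (x : H) : f (r • x) = f x := by
  rw [← Complex.coe_smul]
  exact hf.smul _ (by simpa using hr.ne') x

variable [FiniteDimensional ℂ H] [MeasurableSpace H] [BorelSpace H] (ν : Measure H)
  [ν.IsAddHaarMeasure]

/-- Integrability over the unit sphere implies integrability against the Gaussian measures. -/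
lemma integrable_radialGauss (hf : IsVectorFrame f W) [Nontrivial H]
    (hi : Integrable (fun u : Metric.sphere (0 : H) 1 => f u) ν.toSphere) (k : ℕ) :
    Integrable f (radialGauss ν k) := by
  rw [← (measurePreserving_polar ν k).integrable_comp_emb measurableEmbedding_polar]
  refine (hi.comp_fst (gaussPow (finrank ℝ H - 1 + k))).congr (.of_forall fun x => ?_)
  exact (hf.smul_real x.2.2.out _).symm

lemma integrable_axialGauss (hf : IsVectorFrame f W) [Nontrivial H]
    (hi : Integrable (fun u : Metric.sphere (0 : H) 1 => f u) ν.toSphere) {p : H} (hp : ‖p‖ = 1)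
    (k : ℕ) : Integrable f (axialGauss ν p k) := by
  refine (hf.integrable_radialGauss ν hi k).mono_measure (withDensity_mono (.of_forall fun x => ?_))
  refine ENNReal.ofReal_le_ofReal ?_
  gcongr
  simpa [hp] using norm_inner_le_norm (𝕜 := ℂ) p x

/-- The mean value identity behind the theorem. A point `x = a u p + r w` (with `a, r > 0`, `|u| = 1`
and `w` a unit vector orthogonal to `p`) is paired with the point `-r u p + a w` orthogonal to `x` in
the span of `p` and `w`: the sum of the values of `f` at the two is `f p + f w`. The exponent is
chosen so that the weight is symmetric under the exchange of `a` and `r`. -/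
theorem integrable_orthogonal_and_integral (hf : IsVectorFrame f W)
    (hi : Integrable (fun u : Metric.sphere (0 : H) 1 => f u) ν.toSphere)
    {d : ℕ} (hd : finrank ℂ H = d + 2) {p : H} (hp : ‖p‖ = 1)
    (ν' : Measure (ℂ ∙ p)ᗮ) [ν'.IsAddHaarMeasure] :
    Integrable (fun w : Metric.sphere (0 : (ℂ ∙ p)ᗮ) 1 => f (w : (ℂ ∙ p)ᗮ)) ν'.toSphere ∧
    (axialGauss ν p (2 * d)).real Set.univ ≠ 0 ∧
    ∫ x, f x ∂(axialGauss ν p (2 * d)) = (axialGauss ν p (2 * d)).real Set.univ / 2 *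
      (f p + ⨍ w, f ((w : (ℂ ∙ p)ᗮ) : H) ∂ν'.toSphere) := by
  have hp0 : p ≠ 0 := by rintro rfl; simp at hp
  have : Fact (finrank ℂ H = (d + 1) + 1) := ⟨hd⟩
  have hK : finrank ℂ (ℂ ∙ p)ᗮ = d + 1 := Submodule.finrank_orthogonal_span_singleton hp0
  have : Nontrivial (ℂ ∙ p)ᗮ := nontrivial_of_finrank_pos (R := ℂ) (by omega)
  have : Nontrivial H := nontrivial_of_finrank_pos (R := ℂ) (by omega)
  obtain ⟨c, hc0, hc, hmp⟩ := exists_measurePreserving_lineProdOrthogonal ν p hp ν' (2 * d)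
  have m1 := measurePreserving_polar (volume : Measure ℂ) (2 * d)
  have m2 := measurePreserving_polar ν' 0
  have e1 : finrank ℝ ℂ - 1 + 2 * d = 2 * d + 1 := by rw [Complex.finrank_real_complex]; omega
  have e2 : finrank ℝ (ℂ ∙ p)ᗮ - 1 + 0 = 2 * d + 1 := by
    rw [finrank_real_of_complex, hK]; omega
  rw [e1] at m1
  rw [e2] at m2
  set θ := gaussPow (2 * d + 1)
  set σ₁ := (volume : Measure ℂ).toSphere
  set σ := ν'.toSphere
  have hσ : σ ≠ 0 := ν'.toSphere_ne_zero
  have hσ₁ : σ₁ ≠ 0 := Measure.toSphere_ne_zero _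
  have hθ : θ ≠ 0 := gaussPow_ne_zero _
  let m := (σ₁.prod θ).prod (σ.prod θ)
  have hmp2 := hmp.comp (m1.prod m2)
  have hemb := (lineProdOrthogonal p hp).toHomeomorph.measurableEmbedding.comp
    ((measurableEmbedding_polar (E := ℂ)).prodMap (measurableEmbedding_polar (E := (ℂ ∙ p)ᗮ)))
  let Ψ : (Metric.sphere (0 : ℂ) 1 × Set.Ioi (0 : ℝ)) ×
      (Metric.sphere (0 : (ℂ ∙ p)ᗮ) 1 × Set.Ioi (0 : ℝ)) → H := fun x =>
    ((x.1.2 : ℝ) • (x.1.1 : ℂ)) • p + (x.2.2 : ℝ) • ((x.2.1 : (ℂ ∙ p)ᗮ) : H)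
  have hΨ : MeasurePreserving Ψ m (c • axialGauss ν p (2 * d)) := hmp2
  have hΨe : MeasurableEmbedding Ψ := hemb
  have hneg : MeasurePreserving (fun u : Metric.sphere (0 : ℂ) 1 => -u) σ₁ σ₁ :=
    toSphere_measurePreserving_neg _
  -- The involution `(u, a, w, r) ↦ (-u, r, w, a)`
  let τ : (Metric.sphere (0 : ℂ) 1 × Set.Ioi (0 : ℝ)) ×
      (Metric.sphere (0 : (ℂ ∙ p)ᗮ) 1 × Set.Ioi (0 : ℝ)) →
      (Metric.sphere (0 : ℂ) 1 × Set.Ioi (0 : ℝ)) ×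
      (Metric.sphere (0 : (ℂ ∙ p)ᗮ) 1 × Set.Ioi (0 : ℝ)) := fun x =>
    ((-x.1.1, x.2.2), (x.2.1, x.1.2))
  have hτ : MeasurePreserving τ m m := by
    exact ((hneg.prod (.id θ)).prod (.id (σ.prod θ))).comp (measurePreserving_exchange σ₁ θ σ)
  have hf1 : Integrable f (c • axialGauss ν p (2 * d)) :=
    (hf.integrable_axialGauss ν hi hp _).smul_measure hc
  have hg : Integrable (f ∘ Ψ) m := (hΨ.integrable_comp_emb hΨe).2 hf1
  have hgτ : Integrable ((f ∘ Ψ) ∘ τ) m := hτ.integrable_comp_of_integrable hg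
  have hsum : ∀ x, (f ∘ Ψ) x + ((f ∘ Ψ) ∘ τ) x = f p + f ((x.2.1 : (ℂ ∙ p)ᗮ) : H) := by
    rintro ⟨⟨u, a⟩, ⟨w, r⟩⟩
    have hw := (Submodule.mem_orthogonal_singleton_iff_inner_right (𝕜 := ℂ)).1 (w : (ℂ ∙ p)ᗮ).2
    exact hf.add_eq_add_polar hp (norm_eq_of_mem_sphere w) hw (norm_eq_of_mem_sphere u) a.2.out
  have hi1 : Integrable (fun x => f p + f ((x.2.1 : (ℂ ∙ p)ᗮ) : H)) m :=
    (hg.add hgτ).congr (.of_forall hsum)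
  have hi2 : Integrable
      (fun x : (Metric.sphere (0 : ℂ) 1 × Set.Ioi (0 : ℝ)) ×
        (Metric.sphere (0 : (ℂ ∙ p)ᗮ) 1 × Set.Ioi (0 : ℝ)) => f ((x.2.1 : (ℂ ∙ p)ᗮ) : H)) m :=
    (hi1.sub (integrable_const (f p))).congr (.of_forall fun x => by simp)
  have hm1 : σ₁.prod θ ≠ 0 := by
    rw [← Measure.measure_univ_ne_zero, ← Set.univ_prod_univ, Measure.prod_prod]
    exact mul_ne_zero (Measure.measure_univ_ne_zero.2 hσ₁) (Measure.measure_univ_ne_zero.2 hθ)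
  have hi3 := hi2.of_comp_snd (f := fun y : Metric.sphere (0 : (ℂ ∙ p)ᗮ) 1 × Set.Ioi (0 : ℝ) =>
    f ((y.1 : (ℂ ∙ p)ᗮ) : H)) hm1
  have hmc : m.real Set.univ = c.toReal * (axialGauss ν p (2 * d)).real Set.univ := by
    rw [← measureReal_ennreal_smul_apply, ← hΨ.map_eq]
    simp [measureReal_def, Measure.map_apply hΨ.measurable]
  have hσr : σ.real Set.univ ≠ 0 := by simpa [measureReal_def, ENNReal.toReal_eq_zero_iff] using hσ
  have hm : m.real Set.univ = (σ₁.prod θ).real Set.univ * (σ.real Set.univ * θ.real Set.univ) := by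
    simp only [m, ← Set.univ_prod_univ, measureReal_prod_prod]
  have hm0 : m.real Set.univ ≠ 0 := by
    rw [hm]
    refine mul_ne_zero ?_ (mul_ne_zero hσr ?_)
    · simpa [measureReal_def, ENNReal.toReal_eq_zero_iff] using hm1
    · simpa [measureReal_def, ENNReal.toReal_eq_zero_iff] using hθ
  refine ⟨hi3.of_comp_fst (f := fun y : Metric.sphere (0 : (ℂ ∙ p)ᗮ) 1 => f (y : (ℂ ∙ p)ᗮ)) hθ,
    fun h => hm0 (by rw [hmc, h, mul_zero]), ?_⟩
  have hint : 2 * ∫ x, f x ∂(c • axialGauss ν p (2 * d)) =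
      m.real Set.univ * f p + ∫ x, f ((x.2.1 : (ℂ ∙ p)ᗮ) : H) ∂m := by
    have i1 : ∫ x, (f ∘ Ψ) x ∂m = ∫ x, f x ∂(c • axialGauss ν p (2 * d)) :=
      hΨ.integral_comp hΨe f
    have i2 : ∫ x, ((f ∘ Ψ) ∘ τ) x ∂m = ∫ x, (f ∘ Ψ) x ∂m := by
      have := integral_map (f := f ∘ Ψ) hτ.aemeasurable (by rw [hτ.map_eq]; exact hg.1)
      rw [hτ.map_eq] at this
      exact this.symm
    rw [two_mul, ← i1]
    nth_rw 2 [← i2]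
    rw [← integral_add hg hgτ, integral_congr_ae (.of_forall hsum),
      integral_add (integrable_const _) hi2, integral_const]
    simp
  have havg : ∫ x, f ((x.2.1 : (ℂ ∙ p)ᗮ) : H) ∂m =
      m.real Set.univ * ⨍ w, f ((w : (ℂ ∙ p)ᗮ) : H) ∂σ := by
    have j1 := integral_fun_snd (μ := σ₁.prod θ) (ν := σ.prod θ)
      (fun y : Metric.sphere (0 : (ℂ ∙ p)ᗮ) 1 × Set.Ioi (0 : ℝ) => f ((y.1 : (ℂ ∙ p)ᗮ) : H))
    have j2 := integral_fun_fst (μ := σ) (ν := θ)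
      (fun y : Metric.sphere (0 : (ℂ ∙ p)ᗮ) 1 => f ((y : (ℂ ∙ p)ᗮ) : H))
    rw [j1, j2, average_eq]
    rw [hm]
    simp only [Complex.real_smul]
    have : (σ.real Set.univ : ℂ) ≠ 0 := by exact_mod_cast hσr
    push_cast
    field_simp
  have hcr : (c.toReal : ℂ) ≠ 0 := by
    exact_mod_cast (ENNReal.toReal_pos hc0 hc).ne'
  rw [integral_smul_measure, havg, hmc, Complex.real_smul] at hint
  apply mul_left_cancel₀ hcr
  push_cast at hint
  linear_combination hint / 2

end IsVectorFrame

/-! ### Frame functions in dimensions two and three -/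

section IsometryInvariance

variable {H : Type*} [NormedAddCommGroup H] [InnerProductSpace ℂ H] [FiniteDimensional ℂ H]

lemma exists_linearIsometryEquiv_apply_eq {p q : H} (hp : ‖p‖ = 1) (hq : ‖q‖ = 1) :
    ∃ U : H ≃ₗᵢ[ℂ] H, U p = q := by
  have hp0 : p ≠ 0 := by rintro rfl; simp at hp
  have hpos : 0 < finrank ℂ H := finrank_pos_iff_exists_ne_zero.2 ⟨p, hp0⟩
  let i₀ : Fin (finrank ℂ H) := ⟨0, hpos⟩
  have key : ∀ x : H, ‖x‖ = 1 → ∃ b : OrthonormalBasis (Fin (finrank ℂ H)) ℂ H, b i₀ = x := by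
    intro x hx
    obtain ⟨b, hb⟩ := Orthonormal.exists_orthonormalBasis_extension_of_card_eq (𝕜 := ℂ)
      (ι := Fin (finrank ℂ H)) (by simp) (v := fun _ => x) (s := {i₀})
      ⟨fun _ => hx, fun i j h => (h (Subsingleton.elim i j)).elim⟩
    exact ⟨b, hb i₀ rfl⟩
  obtain ⟨b, hb⟩ := key p hp
  obtain ⟨b', hb'⟩ := key q hq
  exact ⟨b.equiv b' (Equiv.refl _), by rw [← hb, ← hb']; simp⟩

variable [MeasurableSpace H] [BorelSpace H] (ν : Measure H) [ν.IsAddHaarMeasure]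

lemma LinearIsometryEquiv.measurePreserving_addHaar (U : H ≃ₗᵢ[ℂ] H) : MeasurePreserving U ν ν := by
  let U' : H ≃L[ℝ] H := U.toContinuousLinearEquiv.restrictScalars ℝ
  have h1 : (ν.map U).IsAddHaarMeasure := U'.isAddHaarMeasure_map ν
  have h2 := Measure.isAddLeftInvariant_eq_smul (ν.map U) ν
  set c := Measure.addHaarScalarFactor (ν.map U) ν
  refine ⟨U.continuous.measurable, ?_⟩
  have h3 : ν.map U (Metric.ball 0 1) = ν (Metric.ball 0 1) := by
    rw [Measure.map_apply U.continuous.measurable measurableSet_ball]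
    congr 1
    ext x
    simp
  rw [h2] at h3 ⊢
  have h4 : ν (Metric.ball 0 1) ≠ 0 := (Metric.measure_ball_pos ν 0 one_pos).ne'
  have h5 : ν (Metric.ball 0 1) ≠ ⊤ := measure_ball_lt_top.ne
  have h6 : (c : ℝ≥0∞) = 1 := by
    refine (ENNReal.mul_left_inj h4 h5).1 ?_
    rw [one_mul]
    exact h3
  have h7 : c = 1 := by exact_mod_cast h6
  rw [h7, one_smul]

lemma axialGauss_univ_eq {p q : H} (hp : ‖p‖ = 1) (hq : ‖q‖ = 1) (k : ℕ) :
    axialGauss ν p k Set.univ = axialGauss ν q k Set.univ := by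
  obtain ⟨U, hU⟩ := exists_linearIsometryEquiv_apply_eq hp hq
  simp only [axialGauss, withDensity_apply _ MeasurableSet.univ, Measure.restrict_univ]
  rw [← (U.measurePreserving_addHaar ν).lintegral_comp (f := fun x : H =>
    ENNReal.ofReal (‖⟪q, x⟫_ℂ‖ ^ k * Real.exp (-‖x‖ ^ 2))) (by fun_prop)]
  simp [← hU]

end IsometryInvariance

namespace IsVectorFrame

variable {H : Type*} [NormedAddCommGroup H] [InnerProductSpace ℂ H] [FiniteDimensional ℂ H]
  {f : H → ℂ} {W : ℂ} [MeasurableSpace H] [BorelSpace H] (ν : Measure H) [ν.IsAddHaarMeasure]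

omit [FiniteDimensional ℂ H] [MeasurableSpace H] [BorelSpace H] in
lemma eq_of_finrank_eq_one (hf : IsVectorFrame f W) (h1 : finrank ℂ H = 1) {x : H}
    (hx : ‖x‖ = 1) : f x = W := by
  have : FiniteDimensional ℂ H := FiniteDimensional.of_finrank_pos (by omega)
  simpa using hf.sum_orthonormal (ι := Unit) (v := fun _ => x)
    ⟨fun _ => hx, fun i j h => (h rfl).elim⟩ (by simp [h1])

/-- In dimension two the mean of a frame function over the unit sphere is `W / 2`. -/
lemma average_eq_of_finrank_eq_two (hf : IsVectorFrame f W) (h2 : finrank ℂ H = 2)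
    (hi : Integrable (fun u : Metric.sphere (0 : H) 1 => f u) ν.toSphere) :
    ⨍ w : Metric.sphere (0 : H) 1, f w ∂ν.toSphere = W / 2 := by
  have : Nontrivial H := nontrivial_of_finrank_pos (R := ℂ) (by omega)
  obtain ⟨p, hp⟩ := exists_norm_eq H zero_le_one
  have hp0 : p ≠ 0 := by rintro rfl; simp at hp
  have : Fact (finrank ℂ H = 1 + 1) := ⟨h2⟩
  have hK : finrank ℂ (ℂ ∙ p)ᗮ = 1 := Submodule.finrank_orthogonal_span_singleton hp0
  have : Nontrivial (ℂ ∙ p)ᗮ := nontrivial_of_finrank_pos (R := ℂ) (by omega)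
  obtain ⟨-, h0, h⟩ := hf.integrable_orthogonal_and_integral ν hi (d := 0) h2 hp Measure.addHaar
  have h3 : ∀ w : Metric.sphere (0 : (ℂ ∙ p)ᗮ) 1, f ((w : (ℂ ∙ p)ᗮ) : H) = W - f p := fun w =>
    (hf.restrict_orthogonal hp).eq_of_finrank_eq_one hK (norm_eq_of_mem_sphere w)
  have : NeZero (Measure.addHaar : Measure (ℂ ∙ p)ᗮ).toSphere := ⟨Measure.toSphere_ne_zero _⟩
  simp only [h3, average_const] at h
  have hax : axialGauss ν p (2 * 0) = radialGauss ν 0 := by simp [axialGauss, radialGauss]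
  rw [hax] at h h0
  have hmp := measurePreserving_polar ν 0
  set θ := gaussPow (finrank ℝ H - 1 + 0)
  rw [← hmp.integral_comp measurableEmbedding_polar,
    integral_congr_ae (.of_forall fun x => hf.smul_real x.2.2.out _),
    integral_fun_fst (fun u : Metric.sphere (0 : H) 1 => f u)] at h
  have hM : (radialGauss ν 0).real Set.univ = ν.toSphere.real Set.univ * θ.real Set.univ := by
    rw [← measureReal_prod_prod, Set.univ_prod_univ, ← hmp.map_eq]
    simp [measureReal_def, Measure.map_apply hmp.measurable]
  rw [hM] at h h0
  have h4 : (ν.toSphere.real Set.univ : ℂ) ≠ 0 := by exact_mod_cast left_ne_zero_of_mul h0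
  have h5 : (θ.real Set.univ : ℂ) ≠ 0 := by exact_mod_cast right_ne_zero_of_mul h0
  rw [average_eq, Complex.real_smul]
  rw [Complex.real_smul] at h
  push_cast at h ⊢
  field_simp
  field_simp at h
  linear_combination h

/-- A frame function on a three-dimensional space that is integrable over the unit sphere is a
quadratic form. -/
theorem exists_quadratic_of_finrank_eq_three (hf : IsVectorFrame f W) (h3 : finrank ℂ H = 3)
    (hi : Integrable (fun u : Metric.sphere (0 : H) 1 => f u) ν.toSphere) :
    ∃ A : H →L[ℂ] H, ∀ x : H, ‖x‖ = 1 → f x = ⟪x, A x⟫_ℂ := by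
  have : Nontrivial H := nontrivial_of_finrank_pos (R := ℂ) (by omega)
  have key : ∀ p : H, ‖p‖ = 1 → (axialGauss ν p 2).real Set.univ ≠ 0 ∧
      ∫ x, f x ∂(axialGauss ν p 2) = (axialGauss ν p 2).real Set.univ / 4 * (f p + W) := by
    intro p hp
    have hp0 : p ≠ 0 := by rintro rfl; simp at hp
    have : Fact (finrank ℂ H = 2 + 1) := ⟨h3⟩
    have hK : finrank ℂ (ℂ ∙ p)ᗮ = 2 := Submodule.finrank_orthogonal_span_singleton hp0
    obtain ⟨h1, h2, h⟩ :=
      hf.integrable_orthogonal_and_integral ν hi (d := 1) h3 hp Measure.addHaar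
    refine ⟨h2, h.trans ?_⟩
    rw [(hf.restrict_orthogonal hp).average_eq_of_finrank_eq_two _ hK h1]
    ring
  obtain ⟨p₀, hp₀⟩ := exists_norm_eq H zero_le_one
  set M : ℝ := (axialGauss ν p₀ 2).real Set.univ
  have hM : ∀ p : H, ‖p‖ = 1 → (axialGauss ν p 2).real Set.univ = M := by
    intro p hp
    simp only [M, measureReal_def, axialGauss_univ_eq ν hp hp₀]
  have hM0 : (M : ℂ) ≠ 0 := by exact_mod_cast (key p₀ hp₀).1
  let F : H → (H →L[ℂ] H) := fun x =>
    (f x * (Real.exp (-‖x‖ ^ 2) : ℂ)) • InnerProductSpace.rankOne ℂ x x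
  have hFi : Integrable F ν := by
    have hdens : ∀ k : ℕ,
        Integrable (fun x => (‖x‖ ^ k * Real.exp (-‖x‖ ^ 2) : ℝ) • f x) ν := by
      intro k
      have h1 := hf.integrable_radialGauss ν hi k
      rw [radialGauss, integrable_withDensity_iff_integrable_smul' (by fun_prop)
        (.of_forall fun x => ENNReal.ofReal_lt_top)] at h1
      refine h1.congr (.of_forall fun x => ?_)
      simp only
      rw [ENNReal.toReal_ofReal (by positivity)]
    have h1 : AEStronglyMeasurable (fun x => f x * (Real.exp (-‖x‖ ^ 2) : ℂ)) ν := by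
      refine (hdens 0).1.congr (.of_forall fun x => ?_)
      simp [mul_comm]
    have h2 : AEStronglyMeasurable (fun x : H => InnerProductSpace.rankOne ℂ x x) ν :=
      Continuous.aestronglyMeasurable
        (isBoundedBilinear_rankOne.continuous.comp (continuous_id.prodMk continuous_id))
    refine (hdens 2).mono (h1.smul h2) (.of_forall fun x => ?_)
    · simp only [F, norm_smul, norm_mul, InnerProductSpace.norm_rankOne, norm_pow, norm_norm,
        Complex.norm_real]
      apply le_of_eq
      ring
  have hF : ∀ p : H, ⟪p, (∫ x, F x ∂ν) p⟫_ℂ = ∫ x, f x ∂(axialGauss ν p 2) := by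
    intro p
    let L : (H →L[ℂ] H) →L[ℂ] ℂ := (innerSL ℂ p).comp (ContinuousLinearMap.apply ℂ H p)
    have h1 : ⟪p, (∫ x, F x ∂ν) p⟫_ℂ = ∫ x, L (F x) ∂ν := (L.integral_comp_comm hFi).symm
    rw [h1, axialGauss, integral_withDensity_eq_integral_toReal_smul (by fun_prop)
      (.of_forall fun x => ENNReal.ofReal_lt_top)]
    refine integral_congr_ae (.of_forall fun x => ?_)
    simp only
    rw [ENNReal.toReal_ofReal (by positivity)]
    have h2 : ⟪x, p⟫_ℂ * ⟪p, x⟫_ℂ = (‖⟪p, x⟫_ℂ‖ : ℂ) ^ 2 := by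
      rw [← inner_conj_symm x p, Complex.conj_mul']
    simp only [L, F, ContinuousLinearMap.comp_apply, ContinuousLinearMap.apply_apply, smul_apply,
      InnerProductSpace.rankOne_apply, innerSL_apply_apply, inner_smul_right, Complex.real_smul]
    push_cast
    rw [← h2]
    ring
  refine ⟨(4 / M : ℂ) • (∫ x, F x ∂ν) - W • 1, fun p hp => ?_⟩
  have h1 := (key p hp).2
  rw [hM p hp, ← hF p] at h1
  simp only [sub_apply, smul_apply, inner_sub_right,
    inner_smul_right, h1, one_apply_eq_self, inner_self_eq_norm_sq_to_K, hp]
  field_simp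
  simp

end IsVectorFrame

/-! ### Gleason's theorem for integrable frame functions -/

namespace IsVectorFrame

/-- In dimension at least four, a function whose restrictions to all hyperplanes are quadratic forms
is a quadratic form: any three vectors lie in a common hyperplane, which makes the function defined
by polarization sesquilinear. -/
lemma exists_quadratic_of_hyperplanes {H : Type*} [NormedAddCommGroup H] [InnerProductSpace ℂ H]
    [FiniteDimensional ℂ H] {f : H → ℂ} {W : ℂ} (hf : IsVectorFrame f W) (h4 : 4 ≤ finrank ℂ H)
    (h : ∀ p : H, ‖p‖ = 1 → ∃ A : (ℂ ∙ p)ᗮ →L[ℂ] (ℂ ∙ p)ᗮ, ∀ w : (ℂ ∙ p)ᗮ, ‖w‖ = 1 →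
      f w = ⟪w, A w⟫_ℂ) :
    ∃ A : H →L[ℂ] H, ∀ x : H, ‖x‖ = 1 → f x = ⟪x, A x⟫_ℂ := by
  let q : H → ℂ := fun x => (‖x‖ : ℂ) ^ 2 * f x
  let B : H → H → ℂ := fun x y => (q (x + y) - q (x - y) - Complex.I * q (x + Complex.I • y) +
    Complex.I * q (x - Complex.I • y)) / 4
  have hB : ∀ x y z : H, ∃ (p : H) (A : (ℂ ∙ p)ᗮ →L[ℂ] (ℂ ∙ p)ᗮ),
      x ∈ (ℂ ∙ p)ᗮ ∧ y ∈ (ℂ ∙ p)ᗮ ∧ z ∈ (ℂ ∙ p)ᗮ ∧ ∀ v w : (ℂ ∙ p)ᗮ, B v w = ⟪v, A w⟫_ℂ := by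
    intro x y z
    let S : Submodule ℂ H := Submodule.span ℂ (Set.range ![x, y, z])
    have hS : finrank ℂ S ≤ 3 := finrank_range_le_card (R := ℂ) ![x, y, z]
    have hpos : 0 < finrank ℂ Sᗮ := by
      have := S.finrank_add_finrank_orthogonal
      omega
    have : Nontrivial Sᗮ := nontrivial_of_finrank_pos hpos
    obtain ⟨p, hp⟩ := exists_norm_eq Sᗮ zero_le_one
    obtain ⟨A, hA⟩ := h p hp
    have hmem : ∀ v ∈ S, v ∈ (ℂ ∙ (p : H))ᗮ := fun v hv =>
      (Submodule.mem_orthogonal_singleton_iff_inner_left (𝕜 := ℂ)).2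
        ((Submodule.mem_orthogonal _ _).1 p.2 v hv)
    have hq : ∀ w : (ℂ ∙ (p : H))ᗮ, q w = ⟪w, A w⟫_ℂ := by
      intro w
      by_cases hw : w = 0
      · simp [hw, q]
      have hw' : (‖w‖ : ℂ) ≠ 0 := by simpa using hw
      have h1 := hA ((‖w‖ : ℂ)⁻¹ • w) (by simp [norm_smul, hw])
      rw [Submodule.coe_smul, hf.smul _ (inv_ne_zero hw')] at h1
      simp only [q, h1, map_smul, inner_smul_left, inner_smul_right, Submodule.coe_norm]
      simp only [map_inv₀, Complex.conj_ofReal]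
      rw [Submodule.coe_norm] at hw'
      field_simp
    refine ⟨p, A, hmem x (Submodule.subset_span ⟨0, rfl⟩), hmem y (Submodule.subset_span ⟨1, rfl⟩),
      hmem z (Submodule.subset_span ⟨2, rfl⟩), fun v w => ?_⟩
    have h1 := inner_map_polarization' (A.adjoint : (ℂ ∙ (p : H))ᗮ →ₗ[ℂ] (ℂ ∙ (p : H))ᗮ) v w
    simp only [ContinuousLinearMap.coe_coe, ContinuousLinearMap.adjoint_inner_left] at h1
    rw [h1, ← hq, ← hq, ← hq, ← hq]
    simp [B]
  have hadd : ∀ x y z, B x (y + z) = B x y + B x z := by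
    intro x y z
    obtain ⟨p, A, hx, hy, hz, hA⟩ := hB x y z
    have h1 := hA ⟨x, hx⟩ (⟨y, hy⟩ + ⟨z, hz⟩)
    rw [map_add, inner_add_right, ← hA, ← hA] at h1
    exact h1
  have hsmul : ∀ (c : ℂ) x y, B x (c • y) = c * B x y := by
    intro c x y
    obtain ⟨p, A, hx, hy, -, hA⟩ := hB x y 0
    have h1 := hA ⟨x, hx⟩ (c • ⟨y, hy⟩)
    rw [map_smul, inner_smul_right, ← hA] at h1
    exact h1
  have hadd' : ∀ x y z, B (x + y) z = B x z + B y z := by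
    intro x y z
    obtain ⟨p, A, hx, hy, hz, hA⟩ := hB x y z
    have h1 := hA (⟨x, hx⟩ + ⟨y, hy⟩) ⟨z, hz⟩
    rw [inner_add_left, ← hA, ← hA] at h1
    exact h1
  have hsmul' : ∀ (c : ℂ) x y, B (c • x) y = (starRingEnd ℂ) c * B x y := by
    intro c x y
    obtain ⟨p, A, hx, hy, -, hA⟩ := hB x y 0
    have h1 := hA (c • ⟨x, hx⟩) ⟨y, hy⟩
    rw [inner_smul_left, ← hA] at h1
    exact h1
  have hself : ∀ x, B x x = q x := by
    intro x
    have e1 : q (x + x) = 4 * q x := by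
      simp only [q, ← two_smul ℂ x, hf.smul 2 two_ne_zero, norm_smul]
      norm_num
      ring
    have e2 : q (x + Complex.I • x) = 2 * q x := by
      have h1 : (1 + Complex.I) ≠ 0 := by intro h; simpa using congrArg Complex.re h
      have h2 : ‖1 + Complex.I‖ ^ 2 = 2 := by
        rw [← Complex.normSq_eq_norm_sq]; simp [Complex.normSq_apply]; norm_num
      have h3 : x + Complex.I • x = (1 + Complex.I) • x := by rw [add_smul, one_smul]
      simp only [q, h3, hf.smul _ h1, norm_smul]
      rw [← Complex.ofReal_pow, mul_pow, h2]
      push_cast; ring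
    have e3 : q (x - Complex.I • x) = 2 * q x := by
      have h1 : (1 - Complex.I) ≠ 0 := by intro h; simpa using congrArg Complex.re h
      have h2 : ‖1 - Complex.I‖ ^ 2 = 2 := by
        rw [← Complex.normSq_eq_norm_sq]; simp [Complex.normSq_apply]; norm_num
      have h3 : x - Complex.I • x = (1 - Complex.I) • x := by rw [sub_smul, one_smul]
      simp only [q, h3, hf.smul _ h1, norm_smul]
      rw [← Complex.ofReal_pow, mul_pow, h2]
      push_cast; ring
    have e4 : q (x - x) = 0 := by simp [q]
    simp only [B, e1, e2, e3, e4]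
    ring
  let Bl : H →ₗ⋆[ℂ] H →ₗ[ℂ] ℂ := LinearMap.mk₂'ₛₗ (starRingEnd ℂ) (RingHom.id ℂ) B
    hadd' hsmul' hadd (fun c x y => hsmul c x y)
  let b := stdOrthonormalBasis ℂ H
  let A : H →ₗ[ℂ] H := ∑ i, (Bl (b i)).smulRight (b i)
  refine ⟨A.toContinuousLinearMap, fun x hx => ?_⟩
  have h1 : f x = Bl x x := by
    show f x = B x x
    rw [hself]; simp [q, hx]
  rw [h1]
  conv_lhs => rw [show Bl x = Bl (∑ i, ⟪b i, x⟫_ℂ • b i) by rw [b.sum_repr' x]]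
  simp [A, mul_comm]

/-- Gleason's theorem for frame functions that are integrable over the unit sphere. -/
theorem exists_quadratic {H : Type*} [NormedAddCommGroup H] [InnerProductSpace ℂ H]
    [FiniteDimensional ℂ H] [MeasurableSpace H] [BorelSpace H] {f : H → ℂ} {W : ℂ}
    (hf : IsVectorFrame f W) (ν : Measure H) [ν.IsAddHaarMeasure] (h3 : 3 ≤ finrank ℂ H)
    (hi : Integrable (fun u : Metric.sphere (0 : H) 1 => f u) ν.toSphere) :
    ∃ A : H →L[ℂ] H, ∀ x : H, ‖x‖ = 1 → f x = ⟪x, A x⟫_ℂ := by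
  obtain ⟨n, hn⟩ := Nat.exists_eq_add_of_le' h3
  induction n generalizing H W with
  | zero => exact hf.exists_quadratic_of_finrank_eq_three ν (by omega) hi
  | succ n ih =>
    refine hf.exists_quadratic_of_hyperplanes (by omega) fun p hp => ?_
    have hp0 : p ≠ 0 := by rintro rfl; simp at hp
    have : Fact (finrank ℂ H = (n + 3) + 1) := ⟨by omega⟩
    have hK : finrank ℂ (ℂ ∙ p)ᗮ = n + 3 := Submodule.finrank_orthogonal_span_singleton hp0
    obtain ⟨h1, -⟩ := hf.integrable_orthogonal_and_integral ν hi (d := n + 2) (by omega) hp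
      Measure.addHaar
    exact ih (hf.restrict_orthogonal hp) Measure.addHaar (by omega) h1 hK

end IsVectorFrame

/-! ### Frame functions on the projective space -/

section ProjSpaceVectors

variable {H : Type*} [NormedAddCommGroup H] [InnerProductSpace ℂ H]

/-- The point of the projective space represented by a unit vector. -/
noncomputable def projPoint (ψ : H) (h : ‖ψ‖ = 1) : ProjSpace H :=
  ⟨InnerProductSpace.rankOne ℂ ψ ψ, ψ, h, rfl⟩

lemma exists_eq_projPoint (p : ProjSpace H) : ∃ (ψ : H) (h : ‖ψ‖ = 1), p = projPoint ψ h := by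
  obtain ⟨ψ, h, hp⟩ := p.isPure
  exact ⟨ψ, h, ProjSpace.ext hp⟩

variable [FiniteDimensional ℂ H]

lemma tr_projPoint_mul (ψ : H) (h : ‖ψ‖ = 1) (A : H →L[ℂ] H) :
    tr ((projPoint ψ h).op * A) = ⟪ψ, A ψ⟫_ℂ := by
  rw [tr_mul_comm, tr, LinearMap.trace_eq_sum_inner _ (basisVec H)]
  simp only [projPoint, ContinuousLinearMap.coe_coe, mul_apply_eq_comp,
    InnerProductSpace.rankOne_apply, map_smul, inner_smul_right]
  rw [← (basisVec H).sum_inner_mul_inner ψ (A ψ)]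

lemma tr_op_mul_re_eq (p : ProjSpace H) (A : selfAdjoint (H →L[ℂ] H)) :
    (((tr (p.op * (A : H →L[ℂ] H))).re : ℝ) : ℂ) = tr (p.op * (A : H →L[ℂ] H)) := by
  rw [← Complex.conj_eq_iff_re, ← tr_star, star_mul, selfAdjoint.star_val_eq, val_selfAdj,
    tr_mul_comm]

lemma tr_one : tr (1 : H →L[ℂ] H) = finrank ℂ H := by
  simp [tr]

lemma tr_op (p : ProjSpace H) : tr p.op = 1 := by
  obtain ⟨ψ, h, rfl⟩ := exists_eq_projPoint p
  have := tr_projPoint_mul ψ h 1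
  rw [mul_one] at this
  simp [this, h]

lemma hsDist_projPoint_eq_iff (ψ φ : H) (hψ : ‖ψ‖ = 1) (hφ : ‖φ‖ = 1) :
    hsDist (projPoint ψ hψ) (projPoint φ hφ) = √2 ↔ ⟪ψ, φ⟫_ℂ = 0 := by
  have h1 : tr (star ((projPoint ψ hψ).op - (projPoint φ hφ).op) *
      ((projPoint ψ hψ).op - (projPoint φ hφ).op)) = ((2 - 2 * ‖⟪ψ, φ⟫_ℂ‖ ^ 2 : ℝ) : ℂ) := by
    rw [star_sub, val_selfAdj, val_selfAdj, sub_mul, mul_sub, mul_sub, val_idem, val_idem]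
    simp only [tr_sub, tr_op, tr_projPoint_mul]
    simp only [projPoint, InnerProductSpace.rankOne_apply, inner_smul_right]
    rw [← inner_conj_symm φ ψ, Complex.conj_mul', Complex.mul_conj']
    push_cast
    ring
  rw [hsDist, h1, Complex.ofReal_re]
  have hle : ‖⟪ψ, φ⟫_ℂ‖ ≤ 1 := by simpa [hψ, hφ] using norm_inner_le_norm (𝕜 := ℂ) ψ φ
  have h0 : 0 ≤ ‖⟪ψ, φ⟫_ℂ‖ := norm_nonneg _
  rw [Real.sqrt_inj (by nlinarith) (by norm_num)]
  constructor
  · intro h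
    simpa using show ‖⟪ψ, φ⟫_ℂ‖ ^ 2 = 0 by linarith
  · intro h
    simp [h]

/-- A Hilbert basis gives a basis of the projective space. -/
lemma isProjBasis_range (b : OrthonormalBasis (Fin (finrank ℂ H)) ℂ H) :
    Function.Injective (fun i => projPoint (b i) (b.norm_eq_one i)) ∧
    IsProjBasis (Set.range fun i => projPoint (b i) (b.norm_eq_one i)) := by
  have hinj : Function.Injective (fun i => projPoint (b i) (b.norm_eq_one i)) := by
    intro i j hij
    by_contra hne
    have h1 := (hsDist_projPoint_eq_iff (b i) (b j) (b.norm_eq_one i) (b.norm_eq_one j)).2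
      (b.orthonormal.2 hne)
    simp only at hij
    rw [hij] at h1
    simp only [hsDist, sub_self, mul_zero, tr, ContinuousLinearMap.toLinearMap_zero, map_zero,
      Complex.zero_re, Real.sqrt_zero] at h1
    exact (Real.sqrt_ne_zero'.2 two_pos) h1.symm
  refine ⟨hinj, ⟨?_, ?_⟩⟩
  · rintro _ ⟨i, rfl⟩ _ ⟨j, rfl⟩ hij
    refine (hsDist_projPoint_eq_iff _ _ _ _).2 (b.orthonormal.2 ?_)
    rintro rfl
    exact hij rfl
  · intro N hN hsub q hq
    by_contra hne
    obtain ⟨ψ, h, rfl⟩ := exists_eq_projPoint q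
    have h1 : ∀ i, ⟪b i, ψ⟫_ℂ = 0 := fun i =>
      (hsDist_projPoint_eq_iff _ _ (b.norm_eq_one i) h).1
        (hN _ (hsub ⟨i, rfl⟩) _ hq fun e => hne ⟨i, e⟩)
    have h2 : ψ = 0 := by rw [← b.sum_repr' ψ]; simp [h1]
    simp [h2] at h

/-- Every function `p ↦ tr (p A)` is a frame function. -/
lemma isFrameFunction_tr (A : H →L[ℂ] H) : IsFrameFunction fun p : ProjSpace H => tr (p.op * A) := by
  refine ⟨tr A, fun x hx hN => ?_⟩
  choose ψ hψ hxψ using fun i => exists_eq_projPoint (x i)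
  have ho : Orthonormal ℂ ψ := by
    refine ⟨hψ, fun i j hij => ?_⟩
    refine (hsDist_projPoint_eq_iff _ _ (hψ i) (hψ j)).1 ?_
    rw [← hxψ, ← hxψ]
    exact hN.prop _ ⟨i, rfl⟩ _ ⟨j, rfl⟩ (hx.ne hij)
  have hspan := ho.linearIndependent.span_eq_top_of_card_eq_finrank' (by simp)
  let b := OrthonormalBasis.mk ho hspan.ge
  have hb : ∀ i, b i = ψ i := by simp [b]
  simp only [hxψ, tr_projPoint_mul]
  rw [tr, LinearMap.trace_eq_sum_inner _ b]
  simp [hb]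

/-- The function on vectors that corresponds to a function on the projective space; it is set to
zero at the origin. -/
noncomputable def liftToVectors (F : ProjSpace H → ℂ) (x : H) : ℂ :=
  open Classical in if h : x ≠ 0 then F ⟨ray x, ray_mem x h⟩ else 0

lemma liftToVectors_of_norm_eq_one (F : ProjSpace H → ℂ) (x : H) (h : ‖x‖ = 1) :
    liftToVectors F x = F (projPoint x h) := by
  have h0 : x ≠ 0 := by rintro rfl; simp at h
  rw [liftToVectors, dif_pos h0]
  congr 1
  exact ProjSpace.ext (ray_unit x h)

lemma QuantumProj.IsFrameFunction.exists_isVectorFrame {F : ProjSpace H → ℂ}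
    (hF : IsFrameFunction F) : ∃ W, IsVectorFrame (liftToVectors F) W := by
  obtain ⟨W, hW⟩ := hF
  refine ⟨W, fun c hc x => ?_, fun b => ?_⟩
  · by_cases hx : x = 0
    · simp [hx]
    · simp only [liftToVectors, ne_eq, smul_eq_zero, hc, hx, or_self, not_false_eq_true, dif_pos]
      congr 1
      exact ProjSpace.ext (ray_smul x c hc)
  · simp only [liftToVectors_of_norm_eq_one F _ (b.norm_eq_one _)]
    exact hW _ (isProjBasis_range b).1 (isProjBasis_range b).2

lemma continuous_sphereProj : Continuous (sphereProj : Metric.sphere (0 : H) 1 → ProjSpace H) := by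
  refine continuous_induced_rng.2 ?_
  exact isBoundedBilinear_rankOne.continuous.comp
    (continuous_subtype_val.prodMk continuous_subtype_val)

variable [MeasurableSpace H] [BorelSpace H]

instance : IsFiniteMeasure (sphereMeasure H) := by
  refine ⟨?_⟩
  rw [sphereMeasure, Measure.smul_apply, smul_eq_mul]
  exact (ENNReal.inv_mul_le_one _).trans_lt ENNReal.one_lt_top

instance : IsFiniteMeasure (projMeasure H) := by
  unfold projMeasure
  infer_instance

/-- Square-integrable frame functions in dimension at least three are of the form `p ↦ tr (p A)`. -/
theorem frameL2_eq_range_tr [CompleteSpace H] (h3 : 3 ≤ finrank ℂ H) :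
    frameL2 H = Set.range fun (A : H →L[ℂ] H) (p : ProjSpace H) => tr (p.op * A) := by
  ext F
  constructor
  · rintro ⟨hF2, hF⟩
    have : Nontrivial H := nontrivial_of_finrank_pos (R := ℂ) (by omega)
    obtain ⟨W, hf⟩ := hF.exists_isVectorFrame
    let : InnerProductSpace ℝ H := InnerProductSpace.complexToReal
    have h1 : Integrable F (projMeasure H) := hF2.integrable one_le_two
    have h2 : Integrable (F ∘ sphereProj) (sphereMeasure H) :=
      h1.comp_measurable continuous_sphereProj.measurable
    have h3 : Integrable (F ∘ sphereProj) (volume : Measure H).toSphere := by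
      rw [sphereMeasure] at h2
      refine (integrable_smul_measure (ENNReal.inv_ne_zero.2 (measure_ne_top _ _)) ?_).1 h2
      exact ENNReal.inv_ne_top.2 (Measure.measure_univ_ne_zero.2 (Measure.toSphere_ne_zero _))
    have h4 : Integrable (fun u : Metric.sphere (0 : H) 1 => liftToVectors F u)
        (volume : Measure H).toSphere := by
      refine h3.congr (.of_forall fun u => ?_)
      exact (liftToVectors_of_norm_eq_one F u (norm_eq_of_mem_sphere u)).symm
    obtain ⟨A, hA⟩ := hf.exists_quadratic volume (by assumption) h4
    refine ⟨A, funext fun p => ?_⟩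
    obtain ⟨ψ, h, rfl⟩ := exists_eq_projPoint p
    show tr _ = _
    rw [tr_projPoint_mul, ← hA ψ h, liftToVectors_of_norm_eq_one F ψ h]
  · rintro ⟨A, rfl⟩
    refine ⟨?_, isFrameFunction_tr A⟩
    have hc : Continuous fun p : ProjSpace H => tr (p.op * A) := by
      have : Continuous (tr : (H →L[ℂ] H) → ℂ) :=
        LinearMap.continuous_of_finiteDimensional
          ((LinearMap.trace ℂ H).comp (ContinuousLinearMap.coeLM ℂ))
      exact this.comp (continuous_op.mul continuous_const)
    refine MemLp.of_bound hc.measurable.aestronglyMeasurable ‖A‖ (.of_forall fun p => ?_)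
    obtain ⟨ψ, h, rfl⟩ := exists_eq_projPoint p
    show ‖tr _‖ ≤ _
    rw [tr_projPoint_mul]
    calc ‖⟪ψ, A ψ⟫_ℂ‖ ≤ ‖ψ‖ * ‖A ψ‖ := norm_inner_le_norm _ _
      _ ≤ ‖ψ‖ * (‖A‖ * ‖ψ‖) := by gcongr; exact A.le_opNorm ψ
      _ = ‖A‖ := by rw [h]; ring

end ProjSpaceVectors

/-! ### Hamilton's and Schrödinger's equations -/

section Dynamics

variable {H : Type*} [NormedAddCommGroup H] [InnerProductSpace ℂ H] [FiniteDimensional ℂ H]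

/-- The real-linear functional `B ↦ Re tr (B A)` on the operators. -/
noncomputable def reTrMul (A : H →L[ℂ] H) : (H →L[ℂ] H) →L[ℝ] ℝ :=
  LinearMap.toContinuousLinearMap
    { toFun := fun B => (tr (B * A)).re
      map_add' := by intro B C; simp [add_mul, tr_add]
      map_smul' := by
        intro c B
        rw [← Complex.coe_smul, smul_mul_assoc, tr_smul]
        simp }

lemma reTrMul_apply (A B : H →L[ℂ] H) : reTrMul A B = (tr (B * A)).re := rfl

lemma hasMFDerivAt_reTrMul (κ c : ℝ) (A : H →L[ℂ] H) (p : ProjSpace H) :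
    HasMFDerivAt 𝓘(ℝ, ModelE H) 𝓘(ℝ, ℝ) (fun q : ProjSpace H => κ * reTrMul A q.op + c) p
      ((κ • reTrMul A).comp (tangentOp p)) := by
  have h1 : HasFDerivAt (fun B : H →L[ℂ] H => κ * reTrMul A B + c) (κ • reTrMul A) p.op :=
    (((reTrMul A).hasFDerivAt).const_mul κ).add_const c
  exact HasMFDerivAt.comp p h1.hasMFDerivAt (mdiff_val p).hasMFDerivAt

lemma contMDiff_reTrMul (κ c : ℝ) (A : H →L[ℂ] H) :
    ContMDiff 𝓘(ℝ, ModelE H) 𝓘(ℝ, ℝ) ∞ (fun q : ProjSpace H => κ * reTrMul A q.op + c) := by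
  have h1 : ContDiff ℝ ∞ (fun B : H →L[ℂ] H => κ * reTrMul A B + c) := by fun_prop
  exact h1.contMDiff.comp contMDiff_val

/-- The vector `-i[A, p]` is the symplectic gradient at `p` of `κ tr (· A)`. -/
lemma omega_eq_reTrMul (κ : ℝ) (p : ProjSpace H) (A : selfAdjoint (H →L[ℂ] H))
    (u v : TangentSpace 𝓘(ℝ, ModelE H) p)
    (hu : tangentOp p u = -Complex.I • comm (A : H →L[ℂ] H) p.op) :
    omega κ p u v = κ * reTrMul (A : H →L[ℂ] H) (tangentOp p v) := by
  obtain ⟨B, hB⟩ := exists_generator p v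
  have h1 := omega_eq κ p u v A B hu hB
  have h2 : tr (tangentOp p v * (A : H →L[ℂ] H)) =
      -Complex.I * tr (p.op * comm (A : H →L[ℂ] H) (B : H →L[ℂ] H)) := by
    rw [hB, smul_mul_assoc, tr_smul]
    congr 1
    simp only [QuantumProj.comm, sub_mul, mul_sub, tr_sub]
    rw [mul_assoc, tr_mul_comm (B : H →L[ℂ] H), mul_assoc, mul_assoc]
  have h3 : (omega κ p u v : ℂ) = κ * tr (tangentOp p v * (A : H →L[ℂ] H)) := by
    rw [h1, h2]; ring
  have h4 := congrArg Complex.re h3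
  rw [Complex.ofReal_re, Complex.re_ofReal_mul] at h4
  exact h4

lemma tangentOp_hamiltonianField_iff (κ : ℝ) (hκ : 0 < κ) (f : ProjSpace H → ℝ) (p : ProjSpace H)
    (A : selfAdjoint (H →L[ℂ] H)) :
    tangentOp p (hamiltonianField κ hκ f p) = -Complex.I • comm (A : H →L[ℂ] H) p.op ↔
      ∀ v, mfderiv 𝓘(ℝ, ModelE H) 𝓘(ℝ, ℝ) f p v =
        κ * reTrMul (A : H →L[ℂ] H) (tangentOp p v) := by
  constructor
  · intro h v
    rw [← hamiltonianField_spec κ hκ f p v]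
    exact omega_eq_reTrMul κ p A _ v h
  · intro h
    obtain ⟨u, hu⟩ := exists_tangent p A
    obtain ⟨X, -, hX⟩ := existsUnique_hamiltonian κ hκ.ne' p
      (show TangentSpace 𝓘(ℝ, ModelE H) p →L[ℝ] ℝ from
        mfderiv 𝓘(ℝ, ModelE H) 𝓘(ℝ, ℝ) f p).toLinearMap
    have h1 := hX u fun v => (omega_eq_reTrMul κ p A u v hu).trans (h v).symm
    have h2 := hX _ (hamiltonianField_spec κ hκ f p)
    rw [h2, ← h1, hu]

/-- A curve in the projective space has velocity `X` if and only if the corresponding curve of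
operators has velocity `tangentOp X`. -/
lemma hasMFDerivAt_curve_iff (γ : ℝ → ProjSpace H) (t : ℝ)
    (X : TangentSpace 𝓘(ℝ, ModelE H) (γ t)) :
    HasMFDerivAt 𝓘(ℝ, ℝ) 𝓘(ℝ, ModelE H) γ t ((1 : ℝ →L[ℝ] ℝ).smulRight X) ↔
      HasDerivAt (fun s => (γ s).op) (tangentOp (γ t) X) t := by
  constructor
  · intro h
    have h1 : HasFDerivAt (fun s => (γ s).op)
        ((tangentOp (γ t)).comp ((1 : ℝ →L[ℝ] ℝ).smulRight X)) t :=
      (HasMFDerivAt.comp t (mdiff_val (γ t)).hasMFDerivAt h).hasFDerivAt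
    refine h1.hasDerivAt.congr_deriv ?_
    show tangentOp (γ t) ((1 : ℝ) • X) = _
    rw [one_smul]
  · intro h
    have hc : ContinuousAt γ t := by
      rw [Topology.IsInducing.continuousAt_iff (f := γ) ⟨rfl⟩]
      exact h.continuousAt
    have hd : MDifferentiableAt 𝓘(ℝ, ℝ) 𝓘(ℝ, ModelE H) γ t := by
      rw [mdifferentiableAt_iff_target]
      refine ⟨hc, ?_⟩
      have := (contDiffAt_ambientChart _ (γ t).op
        (exists_mem_affChart_source (γ t)).choose_spec).differentiableAt (by simp)
      exact (this.comp t h.differentiableAt).mdifferentiableAt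
    have h1 := HasMFDerivAt.comp t (mdiff_val (γ t)).hasMFDerivAt hd.hasMFDerivAt
    have h2 := congrArg (fun L => L (1 : ℝ)) (hasMFDerivAt_unique h1 h.hasFDerivAt.hasMFDerivAt)
    have h3 : tangentOp (γ t) (mfderiv 𝓘(ℝ, ℝ) 𝓘(ℝ, ModelE H) γ t (1 : ℝ)) =
        tangentOp (γ t) X := h2.trans (one_smul ℝ _)
    have h4 := tangentOp_injective _ h3
    have h5 : mfderiv 𝓘(ℝ, ℝ) 𝓘(ℝ, ModelE H) γ t = (1 : ℝ →L[ℝ] ℝ).smulRight X := by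
      apply ContinuousLinearMap.ext_ring
      refine h4.trans ?_
      exact (one_smul ℝ X).symm
    rw [← h5]
    exact hd.hasMFDerivAt

/-- If the Hamiltonian vector field of `f` is `p ↦ -i[K, p]`, then Hamilton's and Schrödinger's
equations have the same solutions. -/
lemma isMIntegralCurveOn_iff (κ : ℝ) (hκ : 0 < κ) (f : ProjSpace H → ℝ)
    (K : selfAdjoint (H →L[ℂ] H))
    (h : ∀ p, tangentOp p (hamiltonianField κ hκ f p) = -Complex.I • comm (K : H →L[ℂ] H) p.op)
    (a b : ℝ) (γ : ℝ → ProjSpace H) :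
    IsMIntegralCurveOn (I := 𝓘(ℝ, ModelE H)) γ (hamiltonianField κ hκ f) (Set.Ioo a b) ↔
      ∀ t ∈ Set.Ioo a b,
        HasDerivAt (fun s => (γ s).op) (-Complex.I • comm (K : H →L[ℂ] H) (γ t).op) t := by
  refine forall₂_congr fun t ht => ?_
  rw [← h, ← hasMFDerivAt_curve_iff]
  exact ⟨fun h' => h'.hasMFDerivAt (Ioo_mem_nhds ht.1 ht.2), fun h' => h'.hasMFDerivWithinAt⟩

set_option synthInstance.maxHeartbeats 200000 in
/-- The solution `e^{-itK} p e^{itK}` of Schrödinger's equation. -/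
lemma exists_schroedinger_curve (K : selfAdjoint (H →L[ℂ] H)) (p : ProjSpace H) :
    ∃ γ : ℝ → ProjSpace H, γ 0 = p ∧ ∀ t,
      HasDerivAt (fun s => (γ s).op) (-Complex.I • comm (K : H →L[ℂ] H) (γ t).op) t := by
  let γ : ℝ → ProjSpace H := fun t => unitaryAct (selfAdjoint.expUnitary (-t • K)) p
  let E : ℝ → H →L[ℂ] H := fun t => NormedSpace.exp (t • (-Complex.I • (K : H →L[ℂ] H)))
  let E' : ℝ → H →L[ℂ] H := fun t => NormedSpace.exp (t • (Complex.I • (K : H →L[ℂ] H)))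
  have hγ : ∀ t, (γ t).op = E t * p.op * E' t := by
    intro t
    have hinv : (selfAdjoint.expUnitary (-t • K))⁻¹ = selfAdjoint.expUnitary (t • K) := by
      refine inv_eq_of_mul_eq_one_right ?_
      rw [← Commute.expUnitary_add]
      · have h0 : -t • K + t • K = 0 := Subtype.ext (by
          show (-t) • (K : H →L[ℂ] H) + t • (K : H →L[ℂ] H) = 0
          rw [neg_smul, neg_add_cancel])
        rw [h0, selfAdjoint.expUnitary_zero]
      · exact ((Commute.refl (K : H →L[ℂ] H)).smul_left _).smul_right _
    simp only [γ, unitaryAct, E, E', hinv, selfAdjoint.expUnitary_coe, selfAdjoint.val_smul]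
    simp only [smul_comm Complex.I, neg_smul, smul_neg]
  refine ⟨γ, ProjSpace.ext (by simp [hγ, E, E']), fun t => ?_⟩
  have h1 : HasDerivAt E (-Complex.I • (K : H →L[ℂ] H) * E t) t :=
    hasDerivAt_exp_smul_const' (𝕂 := ℝ) (-Complex.I • (K : H →L[ℂ] H)) t
  have h2 : HasDerivAt E' (E' t * (Complex.I • (K : H →L[ℂ] H))) t :=
    hasDerivAt_exp_smul_const (𝕂 := ℝ) (Complex.I • (K : H →L[ℂ] H)) t
  have h3 := (h1.mul_const p.op).mul h2
  simp only [hγ]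
  refine h3.congr_deriv ?_
  simp only [QuantumProj.comm, smul_mul_assoc, mul_smul_comm, smul_sub, neg_smul, neg_mul, mul_assoc]
  abel

/-- A function on the projective space with vanishing differential is constant: the affine charts are
onto the model space, and all contain the line of `∑ j, b_j`. -/
lemma eq_of_mfderiv_eq_zero (f : ProjSpace H → ℝ)
    (hd : MDifferentiable 𝓘(ℝ, ModelE H) 𝓘(ℝ, ℝ) f)
    (h0 : ∀ p v, mfderiv 𝓘(ℝ, ModelE H) 𝓘(ℝ, ℝ) f p v = 0) (p q : ProjSpace H) : f p = f q := by
  have hvec : ∀ h : Fin (finrank ℂ H), affVec h (fun _ => 1) = ∑ j, basisVec H j := by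
    intro h
    rw [Fintype.sum_eq_add_sum_subtype_ne _ h, ← (otherIdx h).sum_comp]
    simp [affVec]
  have key : ∀ p : ProjSpace H, ∃ h : Fin (finrank ℂ H),
      f p = f ((affChart h).symm (fun _ => 1)) := by
    intro p
    obtain ⟨h, hp⟩ := exists_mem_affChart_source p
    refine ⟨h, ?_⟩
    have hat : affChart h ∈ atlas (ModelE H) (ProjSpace H) := ⟨h, rfl⟩
    have hF : ∀ w : ModelE H, HasFDerivAt (f ∘ (affChart h).symm) (0 : ModelE H →L[ℝ] ℝ) w := by
      intro w
      have h1 : MDifferentiableAt 𝓘(ℝ, ModelE H) 𝓘(ℝ, ModelE H) (affChart h).symm w :=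
        (mdifferentiable_of_mem_atlas hat).mdifferentiableAt_symm (Set.mem_univ w)
      have h2 := HasMFDerivAt.comp w (hd _).hasMFDerivAt h1.hasMFDerivAt
      have h3 := h2.hasFDerivAt
      refine h3.congr_fderiv ?_
      ext v
      exact h0 _ _
    have hconst := is_const_of_fderiv_eq_zero (𝕜 := ℝ) (f := f ∘ (affChart h).symm)
      (fun w => (hF w).differentiableAt) (fun w => (hF w).fderiv) (affChart h p) (fun _ => 1)
    simpa [(affChart h).left_inv hp] using hconst
  obtain ⟨h, hp⟩ := key p
  obtain ⟨h', hq⟩ := key q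
  rw [hp, hq]
  congr 1
  apply ProjSpace.ext
  show ray (affVec h _) = ray (affVec h' _)
  rw [hvec, hvec]

end Dynamics

/-! ### Unitarily invariant functionals -/

section Invariants

variable {H : Type*} [NormedAddCommGroup H] [InnerProductSpace ℂ H] [FiniteDimensional ℂ H]

/-- The rank-one projector of a unit vector, as a self-adjoint operator. -/
noncomputable def selfAdjointPoint (ψ : H) (h : ‖ψ‖ = 1) : selfAdjoint (H →L[ℂ] H) :=
  ⟨(projPoint ψ h).op, val_selfAdj _⟩

/-- The spectral theorem, as a decomposition into rank-one projectors. -/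
lemma exists_eq_sum_selfAdjointPoint (A : selfAdjoint (H →L[ℂ] H)) :
    ∃ (b : OrthonormalBasis (Fin (finrank ℂ H)) ℂ H) (l : Fin (finrank ℂ H) → ℝ),
      A = ∑ i, l i • selfAdjointPoint (b i) (b.norm_eq_one i) := by
  have hA : ((A : H →L[ℂ] H) : H →ₗ[ℂ] H).IsSymmetric :=
    ContinuousLinearMap.isSelfAdjoint_iff_isSymmetric.1 A.2
  let b := hA.eigenvectorBasis rfl
  refine ⟨b, hA.eigenvalues rfl, Subtype.ext ?_⟩
  refine ContinuousLinearMap.coe_injective (b.toBasis.ext fun j => ?_)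
  have h1 : (A : H →L[ℂ] H) (b j) = (hA.eigenvalues rfl j : ℂ) • b j :=
    hA.apply_eigenvectorBasis rfl j
  have h2 : ∀ i, (projPoint (b i) (b.norm_eq_one i)).op (b j) = if i = j then b j else 0 := by
    intro i
    simp only [projPoint, InnerProductSpace.rankOne_apply,
      orthonormal_iff_ite.mp b.orthonormal]
    split_ifs with h <;> simp [h]
  simp only [OrthonormalBasis.coe_toBasis, ContinuousLinearMap.coe_coe, h1]
  simp [selfAdjointPoint, h2]

/-- A real-linear functional on the self-adjoint operators that is invariant under unitary
conjugation is a multiple of the trace. -/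
lemma exists_eq_mul_tr (C : selfAdjoint (H →L[ℂ] H) →ₗ[ℝ] ℝ)
    (hC : ∀ (A : selfAdjoint (H →L[ℂ] H)) (U : unitary (H →L[ℂ] H)), C (unitaryConj U A) = C A) :
    ∃ c : ℝ, ∀ A : selfAdjoint (H →L[ℂ] H), (C A : ℂ) = c * tr (A : H →L[ℂ] H) := by
  have hconst : ∀ (ψ φ : H) (hψ : ‖ψ‖ = 1) (hφ : ‖φ‖ = 1),
      C (selfAdjointPoint ψ hψ) = C (selfAdjointPoint φ hφ) := by
    intro ψ φ hψ hφ
    obtain ⟨V, hV⟩ := exists_linearIsometryEquiv_apply_eq hψ hφ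
    let U : unitary (H →L[ℂ] H) := Unitary.linearIsometryEquiv.symm V
    have hU : ∀ x, (U : H →L[ℂ] H) x = V x := fun x => rfl
    have hU' : ((U⁻¹ : unitary (H →L[ℂ] H)) : H →L[ℂ] H) φ = ψ := by
      have h1 := congrArg (fun T : unitary (H →L[ℂ] H) => (T : H →L[ℂ] H) ψ) (inv_mul_cancel U)
      simp only [Submonoid.coe_mul, mul_apply_eq_comp, hU, hV] at h1
      exact h1
    rw [← hC (selfAdjointPoint φ hφ) U]
    congr 1
    refine Subtype.ext (ContinuousLinearMap.ext fun x => ?_)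
    simp only [selfAdjointPoint, unitaryConj, projPoint, mul_apply_eq_comp,
      InnerProductSpace.rankOne_apply, map_smul, hU', hU]
    rw [← hV, V.inner_map_map]
  by_cases hH : ∃ ψ : H, ‖ψ‖ = 1
  · obtain ⟨ψ, hψ⟩ := hH
    refine ⟨C (selfAdjointPoint ψ hψ), fun A => ?_⟩
    obtain ⟨b, l, hA⟩ := exists_eq_sum_selfAdjointPoint A
    have h1 : C A = C (selfAdjointPoint ψ hψ) * ∑ i, l i := by
      conv_lhs => rw [hA]
      simp only [map_sum, map_smul, hconst _ ψ (b.norm_eq_one _) hψ, smul_eq_mul]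
      rw [Finset.mul_sum]
      exact Finset.sum_congr rfl fun i _ => mul_comm _ _
    have h2 : tr (A : H →L[ℂ] H) = ∑ i, (l i : ℂ) := by
      conv_lhs => rw [hA]
      simp only [AddSubgroup.val_finsetSum, selfAdjoint.val_smul, tr, ContinuousLinearMap.toLinearMap_sum,
        map_sum]
      refine Finset.sum_congr rfl fun i _ => ?_
      have h3 := tr_op (projPoint (b i) (b.norm_eq_one i))
      have h4 := tr_smul (l i : ℂ) (projPoint (b i) (b.norm_eq_one i)).op
      rw [h3, mul_one] at h4
      exact h4
    rw [h1, h2]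
    push_cast
    rfl
  · refine ⟨0, fun A => ?_⟩
    have : Subsingleton H := by
      by_contra h
      rw [not_subsingleton_iff_nontrivial] at h
      exact hH (exists_norm_eq H zero_le_one)
    have : A = 0 := Subtype.ext (Subsingleton.elim _ _)
    simp [this, tr]

end Invariants

/-! ### The observables -/

section Quantization

variable {H : Type*} [NormedAddCommGroup H] [InnerProductSpace ℂ H] [FiniteDimensional ℂ H]

/-- An operator with vanishing expectation values is zero. -/
lemma eq_zero_of_tr_op_mul_eq_zero (A : H →L[ℂ] H) (h : ∀ p : ProjSpace H, tr (p.op * A) = 0) :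
    A = 0 := by
  have h1 : ∀ x : H, ⟪x, A x⟫_ℂ = 0 := by
    intro x
    by_cases hx : x = 0
    · simp [hx]
    have hx' : (‖x‖ : ℂ) ≠ 0 := by simpa using hx
    have h2 := h (projPoint ((‖x‖ : ℂ)⁻¹ • x) (by simp [norm_smul, hx]))
    rw [tr_projPoint_mul, map_smul, inner_smul_left, inner_smul_right] at h2
    simpa [hx] using h2
  have h3 : (A : H →ₗ[ℂ] H) = 0 := (inner_map_self_eq_zero _).1 fun x => by
    rw [← inner_conj_symm]; simp [h1]
  exact ContinuousLinearMap.coe_injective h3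

/-- The map `A ↦ (p ↦ κ tr (p A) + c tr A)` on all operators. -/
noncomputable def traceSymbol (κ c : ℝ) : (H →L[ℂ] H) →ₗ[ℂ] (ProjSpace H → ℂ) where
  toFun A p := κ * tr (p.op * A) + c * tr A
  map_add' A B := by funext p; simp only [mul_add, tr_add, Pi.add_apply]; ring
  map_smul' z A := by
    funext p
    simp only [mul_smul_comm, tr_smul, Pi.smul_apply, smul_eq_mul, RingHom.id_apply]; ring

lemma traceSymbol_apply (κ c : ℝ) (A : H →L[ℂ] H) (p : ProjSpace H) :
    traceSymbol κ c A p = κ * tr (p.op * A) + c * tr A := rfl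

lemma sum_tr_projPoint (A : H →L[ℂ] H) :
    ∑ i, tr ((projPoint (basisVec H i) ((basisVec H).norm_eq_one i)).op * A) = tr A := by
  simp only [tr_projPoint_mul]
  exact (LinearMap.trace_eq_sum_inner _ (basisVec H)).symm

lemma traceSymbol_injective {κ c : ℝ} (hκ : κ ≠ 0) (hc : κ + finrank ℂ H * c ≠ 0) :
    Function.Injective (traceSymbol (H := H) κ c) := by
  rw [injective_iff_map_eq_zero]
  intro A hA
  have h1 : ∀ p : ProjSpace H, (κ : ℂ) * tr (p.op * A) + c * tr A = 0 := fun p => congrFun hA p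
  have h2 : tr A = 0 := by
    have h3 := Finset.sum_eq_zero fun i (_ : i ∈ Finset.univ) =>
      h1 (projPoint (basisVec H i) ((basisVec H).norm_eq_one i))
    rw [Finset.sum_add_distrib, ← Finset.mul_sum, sum_tr_projPoint] at h3
    simp only [Finset.sum_const, Finset.card_univ, Fintype.card_fin, nsmul_eq_mul] at h3
    have h4 : ((κ + finrank ℂ H * c : ℝ) : ℂ) * tr A = 0 := by
      push_cast; linear_combination h3
    exact (mul_eq_zero.1 h4).resolve_left (by exact_mod_cast hc)
  refine eq_zero_of_tr_op_mul_eq_zero A fun p => ?_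
  have h5 := h1 p
  rw [h2, mul_zero, add_zero] at h5
  exact (mul_eq_zero.1 h5).resolve_left (by exact_mod_cast hκ)

lemma range_traceSymbol {κ c : ℝ} (hκ : κ ≠ 0) (hc : κ + finrank ℂ H * c ≠ 0) :
    Set.range (traceSymbol (H := H) κ c) =
      Set.range fun (A : H →L[ℂ] H) (p : ProjSpace H) => tr (p.op * A) := by
  have hκ' : (κ : ℂ) ≠ 0 := by exact_mod_cast hκ
  have hc' : (κ : ℂ) + finrank ℂ H * c ≠ 0 := by exact_mod_cast hc
  apply Set.Subset.antisymm
  · rintro _ ⟨A, rfl⟩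
    refine ⟨(κ : ℂ) • A + (c * tr A) • 1, funext fun p => ?_⟩
    simp only [traceSymbol_apply, mul_add, tr_add, mul_smul_comm, tr_smul, mul_one, tr_op]
  · rintro _ ⟨T, rfl⟩
    -- `tr A = tr T / (κ + n c)` for the preimage `A` of `T`
    refine ⟨(κ : ℂ)⁻¹ • (T - (c * (tr T / (κ + finrank ℂ H * c))) • 1), funext fun p => ?_⟩
    simp only [traceSymbol_apply, mul_sub, tr_sub, mul_smul_comm, tr_smul, mul_one, tr_op, tr_one]
    have hτ := div_mul_cancel₀ (tr T) hc'
    set τ := tr T / (κ + finrank ℂ H * c)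
    field_simp
    linear_combination -(c : ℂ) * hτ

lemma tr_unitaryAct_mul (U : unitary (H →L[ℂ] H)) (p : ProjSpace H)
    (A : selfAdjoint (H →L[ℂ] H)) : tr ((unitaryAct U p).op * (A : H →L[ℂ] H)) =
      tr (p.op * (unitaryConj U A : H →L[ℂ] H)) := by
  simp only [unitaryAct, unitaryConj]
  rw [mul_assoc, mul_assoc, tr_mul_comm, mul_assoc, mul_assoc]

lemma tr_unitaryConj (U : unitary (H →L[ℂ] H)) (A : selfAdjoint (H →L[ℂ] H)) :
    tr (unitaryConj U A : H →L[ℂ] H) = tr (A : H →L[ℂ] H) := by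
  have h : (U : H →L[ℂ] H) * ((U⁻¹ : unitary (H →L[ℂ] H)) : H →L[ℂ] H) = 1 :=
    congrArg Subtype.val (mul_inv_cancel U)
  simp only [unitaryConj]
  rw [tr_mul_comm, ← mul_assoc, h, one_mul]

/-- The observables `κ tr (p A) + c tr A` satisfy the four requirements. -/
lemma requirements_of_eq_trace {κ c : ℝ} (hκ : 0 < κ) (hc : κ + finrank ℂ H * c ≠ 0)
    (O : selfAdjoint (H →L[ℂ] H) → ProjSpace H → ℝ)
    (hO : ∀ (A : selfAdjoint (H →L[ℂ] H)) (p : ProjSpace H),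
      (O A p : ℂ) = κ * tr (p.op * (A : H →L[ℂ] H)) + c * tr (A : H →L[ℂ] H)) :
    ReqInjective O ∧ ReqLinear O ∧ ReqDynamics κ hκ O ∧ ReqCovariant O := by
  have hO' : ∀ (A : selfAdjoint (H →L[ℂ] H)) (p : ProjSpace H),
      O A p = κ * reTrMul (A : H →L[ℂ] H) p.op + c * (tr (A : H →L[ℂ] H)).re := by
    intro A p
    have := congrArg Complex.re (hO A p)
    rw [Complex.ofReal_re, Complex.add_re, Complex.re_ofReal_mul, Complex.re_ofReal_mul] at this
    exact this
  refine ⟨fun A B hAB => ?_, ⟨fun A B => ?_, fun r A => ?_⟩, fun K => ?_, fun A U p => ?_⟩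
  · refine Subtype.ext (traceSymbol_injective hκ.ne' hc (funext fun p => ?_))
    rw [traceSymbol_apply, traceSymbol_apply, ← hO, ← hO, hAB]
  · funext p
    apply Complex.ofReal_injective
    simp only [Pi.add_apply, Complex.ofReal_add, hO, AddSubgroup.coe_add, mul_add, tr_add]
    ring
  · funext p
    apply Complex.ofReal_injective
    simp only [Pi.smul_apply, smul_eq_mul, Complex.ofReal_mul, hO, selfAdjoint.val_smul]
    rw [← Complex.coe_smul, mul_smul_comm, tr_smul, tr_smul]
    ring
  · have hK : O K = fun q => κ * reTrMul (K : H →L[ℂ] H) q.op + c * (tr (K : H →L[ℂ] H)).re :=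
      funext (hO' K)
    refine ⟨?_, isMIntegralCurveOn_iff κ hκ (O K) K fun p => ?_⟩
    · rw [hK]
      exact (contMDiff_reTrMul κ _ _).of_le (by simp)
    · rw [tangentOp_hamiltonianField_iff, hK, (hasMFDerivAt_reTrMul κ _ _ p).mfderiv]
      intro v
      rfl
  · apply Complex.ofReal_injective
    rw [hO, hO, tr_unitaryAct_mul, tr_unitaryConj]

/-- The requirements determine the observables up to the multiple `c` of the trace. -/
lemma exists_eq_trace_of_requirements {κ : ℝ} (hκ : 0 < κ) (hn : 0 < finrank ℂ H)
    (O : selfAdjoint (H →L[ℂ] H) → ProjSpace H → ℝ) (h1 : ReqInjective O) (h2 : ReqLinear O)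
    (h3 : ReqDynamics κ hκ O) (h4 : ReqCovariant O) :
    ∃ c : ℝ, (∀ (A : selfAdjoint (H →L[ℂ] H)) (p : ProjSpace H),
      (O A p : ℂ) = κ * tr (p.op * (A : H →L[ℂ] H)) + c * tr (A : H →L[ℂ] H)) ∧
      κ + finrank ℂ H * c ≠ 0 := by
  have : Nontrivial H := nontrivial_of_finrank_pos (R := ℂ) hn
  obtain ⟨ψ, hψ⟩ := exists_norm_eq H zero_le_one
  let p₀ : ProjSpace H := projPoint ψ hψ
  let C : selfAdjoint (H →L[ℂ] H) → ℝ := fun A => O A p₀ - κ * reTrMul (A : H →L[ℂ] H) p₀.op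
  have hham : ∀ (K : selfAdjoint (H →L[ℂ] H)) (p : ProjSpace H) v,
      mfderiv 𝓘(ℝ, ModelE H) 𝓘(ℝ, ℝ) (O K) p v =
        κ * reTrMul (K : H →L[ℂ] H) (tangentOp p v) := by
    intro K p
    rw [← tangentOp_hamiltonianField_iff κ hκ]
    obtain ⟨γ, h0, hγ⟩ := exists_schroedinger_curve K p
    have h5 := ((h3 K).2 (-1) 1 γ).2 fun t _ => hγ t
    have h6 := (h5 0 (by simp)).hasMFDerivAt (Ioo_mem_nhds (by simp) (by simp))
    rw [hasMFDerivAt_curve_iff] at h6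
    rw [← h0]
    exact h6.unique (hγ 0)
  have hconst : ∀ (K : selfAdjoint (H →L[ℂ] H)) (p : ProjSpace H),
      O K p = κ * reTrMul (K : H →L[ℂ] H) p.op + C K := by
    intro K p
    have hd : ∀ q, ∃ L : TangentSpace 𝓘(ℝ, ModelE H) q →L[ℝ] ℝ,
        HasMFDerivAt 𝓘(ℝ, ModelE H) 𝓘(ℝ, ℝ)
          (fun q : ProjSpace H => O K q - (κ * reTrMul (K : H →L[ℂ] H) q.op + 0)) q L ∧
        ∀ v, L v = 0 := fun q =>
      ⟨_, (((h3 K).1.mdifferentiable (by simp)) q).hasMFDerivAt.sub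
        (hasMFDerivAt_reTrMul κ 0 (K : H →L[ℂ] H) q), fun v => sub_eq_zero.2 (hham K q v)⟩
    choose L hL hL0 using hd
    have h5 := eq_of_mfderiv_eq_zero _ (fun q => (hL q).mdifferentiableAt) (fun q v => by
      rw [(hL q).mfderiv]
      exact hL0 q v) p p₀
    simp only [add_zero] at h5
    simp only [C]
    linarith
  have hCadd : ∀ A B, C (A + B) = C A + C B := by
    intro A B
    simp only [C, h2.map_add, Pi.add_apply, AddSubgroup.coe_add, reTrMul_apply, mul_add, tr_add,
      Complex.add_re]
    ring
  have hCsmul : ∀ (r : ℝ) A, C (r • A) = r * C A := by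
    intro r A
    simp only [C, h2.map_smul, Pi.smul_apply, selfAdjoint.val_smul, reTrMul_apply, smul_eq_mul]
    rw [← Complex.coe_smul, mul_smul_comm, tr_smul, Complex.re_ofReal_mul]
    ring
  let Cl : selfAdjoint (H →L[ℂ] H) →ₗ[ℝ] ℝ :=
    { toFun := C, map_add' := hCadd, map_smul' := hCsmul }
  obtain ⟨c, hc⟩ := exists_eq_mul_tr Cl (by
    intro A U
    have h5 := h4 A U p₀
    rw [hconst, hconst] at h5
    rw [reTrMul_apply, reTrMul_apply, tr_unitaryAct_mul] at h5
    exact (add_left_cancel h5).symm)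
  have hO : ∀ (A : selfAdjoint (H →L[ℂ] H)) (p : ProjSpace H),
      (O A p : ℂ) = κ * tr (p.op * (A : H →L[ℂ] H)) + c * tr (A : H →L[ℂ] H) := by
    intro A p
    rw [← hc A, hconst, Complex.ofReal_add, Complex.ofReal_mul, reTrMul_apply, tr_op_mul_re_eq]
    rfl
  refine ⟨c, hO, fun h0 => ?_⟩
  -- otherwise the identity and `0` have the same image
  let one : selfAdjoint (H →L[ℂ] H) := ⟨1, star_one _⟩
  have h5 : O one = O 0 := by
    funext p
    apply Complex.ofReal_injective
    rw [hO, hO]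
    have h6 : ((κ + finrank ℂ H * c : ℝ) : ℂ) = 0 := by rw [h0]; simp
    push_cast at h6
    have h7 : tr (0 : H →L[ℂ] H) = 0 := by simpa using tr_smul 0 (0 : H →L[ℂ] H)
    simp only [one, mul_one, tr_op, tr_one, ZeroMemClass.coe_zero, mul_zero, h7]
    linear_combination h6
  have h8 := congrArg Subtype.val (h1 h5)
  exact one_ne_zero (α := H →L[ℂ] H) h8

end Quantization

theorem theorem4p1 {H : Type*} [NormedAddCommGroup H] [InnerProductSpace ℂ H]
    [FiniteDimensional ℂ H] [CompleteSpace H] [MeasurableSpace H] [BorelSpace H]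
    (n : ℕ) (hdim : Module.finrank ℂ H = n) (hn : 1 < n) (κ : ℝ) (hκ : 0 < κ)
    (O : selfAdjoint (H →L[ℂ] H) → ProjSpace H → ℝ) :
    ((ReqInjective O ∧ ReqLinear O ∧ ReqDynamics κ hκ O ∧ ReqCovariant O) ↔
      ∃ c : ℝ, (∀ (A : selfAdjoint (H →L[ℂ] H)) (p : ProjSpace H),
          (O A p : ℂ) = κ * tr (p.op * (A : H →L[ℂ] H)) + c * tr (A : H →L[ℂ] H)) ∧
        κ + n * c ≠ 0) ∧
    (ReqInjective O → ReqLinear O → ReqDynamics κ hκ O → ReqCovariant O →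
      ∃ L : (H →L[ℂ] H) →ₗ[ℂ] (ProjSpace H → ℂ),
        (∀ (A : selfAdjoint (H →L[ℂ] H)) (p : ProjSpace H), L A p = (O A p : ℂ)) ∧
        (∀ L' : (H →L[ℂ] H) →ₗ[ℂ] (ProjSpace H → ℂ),
          (∀ (A : selfAdjoint (H →L[ℂ] H)) (p : ProjSpace H), L' A p = (O A p : ℂ)) → L' = L) ∧
        Function.Injective L ∧
        (2 < n → Set.range L = frameL2 H)) := by
  subst hdim
  refine ⟨⟨?_, ?_⟩, fun h1 h2 h3 h4 => ?_⟩
  · rintro ⟨h1, h2, h3, h4⟩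
    exact exists_eq_trace_of_requirements hκ (by omega) O h1 h2 h3 h4
  · rintro ⟨c, hO, hc⟩
    exact requirements_of_eq_trace hκ hc O hO
  · obtain ⟨c, hO, hc⟩ := exists_eq_trace_of_requirements hκ (by omega) O h1 h2 h3 h4
    refine ⟨traceSymbol κ c, fun A p => (hO A p).symm, fun L' hL' => ?_,
      traceSymbol_injective hκ.ne' hc, fun h => ?_⟩
    · refine LinearMap.ext fun A => ?_
      have hsa : ∀ B : selfAdjoint (H →L[ℂ] H), L' B = traceSymbol κ c B := fun B =>
        funext fun p => (hL' B p).trans (hO B p)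
      rw [← realPart_add_I_smul_imaginaryPart A, map_add, map_add, map_smul, map_smul, hsa, hsa]
    · rw [range_traceSymbol hκ.ne' hc, frameL2_eq_range_tr h]
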